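/- Let $V$ be a real Euclidean vector space of dimension $4p$ with two anticommuting complex structures $\mathbb I,\mathbb J$ preserving the scalar product. Let $\mathfrak{sp}(p)$ be the Lie algebra of skew-symmetric endomorphisms of $V$ commuting with $\mathbb I$ and $\mathbb J$, and let $V_c=V\otimes\mathbb C$, a complex $\mathfrak{sp}(p)$-module. For $0\le t\le p$ let $U_t$ denote the irreducible complex $\mathfrak{sp}(p)$-module with highest weight $(1,\dots,1,0,\dots,0)$ ($t$ entries equal to $1$); put $U_{-1}=U_{p+1}=0$. Fix $0\le s\le p$. Given a decomposition $V_c=W_1\oplus W_2$ into irreducible $\mathfrak{sp}(p)$-submodules, each $W_i\otimes U_s$ is multiplicity free. Let $U_{i,s\pm1}\subset W_i\otimes U_s$ be its irreducible summand isomorphic to $U_{s\pm1}$ (zero if there is none), and let $\pi_{i,\pm}$ be the invariant projection of $V_c\otimes U_s=(W_1\otimes U_s)\oplus(W_2\otimes U_s)$ onto $U_{i,s\pm1}$, i.e. the projection along the sum of the other irreducible summands of $W_i\otimes U_s$ and of $W_{3-i}\otimes U_s$. For an open set $\Omega\subset V$ and $f\in\mathcal C^\infty(\Omega,U_s)$ the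 Stein--Weiss gradients are $$D_{i,\pm}(f)=\pi_{i,\pm}(\nabla f),\qquad \nabla f=\sum_{\alpha=1}^{4p}e_\alpha\otimes\partial_{e_\alpha}f,\qquad i=1,2,$$ where $(e_\alpha)$ is an orthonormal basis of $V$. Let $V_c=W_1\oplus W_2$ and $V_c=\tilde W_1\oplus\tilde W_2$ be two decompositions into irreducible $\mathfrak{sp}(p)$-submodules, with Stein--Weiss gradients $D_{i,\pm}$ and $\tilde D_{i,\pm}$ respectively. Then, for every $f\in\mathcal C^\infty(\Omega,U_s)$ and for each of the two choices of the sign, $$D_{1,\pm}(f)=D_{2,\pm}(f)=0\ \text{ on }\Omega\iff\tilde D_{1,\pm}(f)=\tilde D_{2,\pm}(f)=0\ \text{ on }\Omega.$$ In particular, all four $D_{i,\pm}(f)$ vanish on $\Omega$ if and only if all four $\tilde D_{i,\pm}(f)$ do. -/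

import Mathlib

open scoped TensorProduct ContDiff

noncomputable section

namespace SteinWeiss

attribute [local instance 100] LieRing.ofAssociativeRing

/-- Two anticommuting complex structures `I`, `J` on a Euclidean space `V`, both preserving the
scalar product.  (The third complex structure is `K = I J`.) -/
structure HypercomplexStructure (V : Type*) [NormedAddCommGroup V] [InnerProductSpace ℝ V] where
  I : V →ₗ[ℝ] V
  J : V →ₗ[ℝ] V
  I_sq : ∀ x, I (I x) = -x
  J_sq : ∀ x, J (J x) = -x
  anticomm : ∀ x, I (J x) = -J (I x)
  inner_I : ∀ x y, inner ℝ (I x) (I y) = inner ℝ x y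
  inner_J : ∀ x y, inner ℝ (J x) (J y) = inner ℝ x y

variable {V : Type*} [NormedAddCommGroup V] [InnerProductSpace ℝ V]

/-- The real Lie algebra `𝔰𝔭(p)`, realized as the Lie algebra of `SO_Q(V)`: the skew-symmetric
endomorphisms of `V` that commute with `I` and `J`. -/
def sp (Q : HypercomplexStructure V) : LieSubalgebra ℝ (Module.End ℝ V) where
  carrier := {A | (∀ x y, inner ℝ (A x) y = -inner ℝ x (A y)) ∧
    (∀ x, A (Q.I x) = Q.I (A x)) ∧ ∀ x, A (Q.J x) = Q.J (A x)}
  add_mem' := by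
    rintro A B ⟨a1, a2, a3⟩ ⟨b1, b2, b3⟩
    refine ⟨fun x y => ?_, fun x => by simp [a2, b2], fun x => by simp [a3, b3]⟩
    simp only [LinearMap.add_apply, inner_add_left, inner_add_right, a1, b1]
    ring
  zero_mem' := by simp
  smul_mem' := by
    rintro c A ⟨a1, a2, a3⟩
    refine ⟨fun x y => ?_, fun x => by simp [a2], fun x => by simp [a3]⟩
    simp only [LinearMap.smul_apply, real_inner_smul_left, real_inner_smul_right, a1]
    ring
  lie_mem' := by
    rintro A B ⟨a1, a2, a3⟩ ⟨b1, b2, b3⟩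
    refine ⟨fun x y => ?_, fun x => ?_, fun x => ?_⟩
    · simp only [Ring.lie_def, LinearMap.sub_apply, Module.End.mul_apply, inner_sub_left,
        inner_sub_right, a1, b1]
      ring
    · simp [Ring.lie_def, a2, b2]
    · simp [Ring.lie_def, a3, b3]

/-- The complexification of `𝔰𝔭(p)`.  Complex `𝔰𝔭(p)`-modules are the same thing as modules over
this complex Lie algebra. -/
abbrev SpC (Q : HypercomplexStructure V) : Type _ := ℂ ⊗[ℝ] sp Q

/-- The complexification `V_c` of `V`, a complex `𝔰𝔭(p)`-module. -/
abbrev Vc (V : Type*) [NormedAddCommGroup V] [InnerProductSpace ℝ V] : Type _ := ℂ ⊗[ℝ] V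

section Weights

variable {p : ℕ}

/-- A quaternionic orthonormal frame: the vectors `e k, I (e k), J (e k), K (e k)` are
orthonormal.  It fixes the Cartan subalgebra and the system of positive roots. -/
def IsFrame (Q : HypercomplexStructure V) (e : Fin p → V) : Prop :=
  Orthonormal ℝ fun a : Fin p × Fin 4 =>
    ![e a.1, Q.I (e a.1), Q.J (e a.1), Q.I (Q.J (e a.1))] a.2

/-- The skew-symmetric endomorphism `v ∧ w : x ↦ ⟨v, x⟩ w - ⟨w, x⟩ v`. -/
def wedgeEnd (v w : V) : Module.End ℝ V :=
  (innerₛₗ ℝ v).smulRight w - (innerₛₗ ℝ w).smulRight v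

/-- For a unit vector `v`, the element of `𝔰𝔭(p)` that sends `v` to `I v` and vanishes on the
orthogonal complement of the quaternionic line of `v`. -/
def torusElement (Q : HypercomplexStructure V) (v : V) : sp Q :=
  ⟨wedgeEnd v (Q.I v) - wedgeEnd (Q.J v) (Q.I (Q.J v)), by
    have hI : ∀ x y : V, inner ℝ x (Q.I y) = -inner ℝ (Q.I x) y := fun x y => by
      rw [← Q.inner_I x (Q.I y), Q.I_sq, inner_neg_right]
    have hJ : ∀ x y : V, inner ℝ x (Q.J y) = -inner ℝ (Q.J x) y := fun x y => by
      rw [← Q.inner_J x (Q.J y), Q.J_sq, inner_neg_right]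
    refine ⟨fun x y => ?_, fun x => ?_, fun x => ?_⟩
    · simp only [wedgeEnd, LinearMap.sub_apply, LinearMap.smulRight_apply, innerₛₗ_apply_apply,
        inner_sub_left, inner_sub_right, real_inner_smul_left, real_inner_smul_right]
      simp only [real_inner_comm x]
      ring
    · simp only [wedgeEnd, LinearMap.sub_apply, LinearMap.smulRight_apply, innerₛₗ_apply_apply,
        hI, map_sub, map_smul, Q.I_sq, inner_neg_left]
      module
    · have h : ∀ x, Q.J (Q.I x) = -Q.I (Q.J x) := fun x => by rw [Q.anticomm, neg_neg]
      simp only [wedgeEnd, LinearMap.sub_apply, LinearMap.smulRight_apply, innerₛₗ_apply_apply,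
        hJ, map_sub, map_smul, h, Q.J_sq, inner_neg_left, map_neg]
      module⟩

/-- `m` is a vector of weight `λ = ∑ λ_k ε_k` (possibly zero): the torus elements `H_k` act on it
by `i λ_k`. -/
def HasWeight (Q : HypercomplexStructure V) (e : Fin p → V) {M : Type*} [AddCommGroup M]
    [Module ℂ M] [LieRingModule (SpC Q) M] (l : Fin p → ℤ) (m : M) : Prop :=
  ∀ k, ⁅((1 : ℂ) ⊗ₜ[ℝ] torusElement Q (e k) : SpC Q), m⁆ = (Complex.I * (l k : ℂ)) • m

/-- The positive roots `ε_k - ε_l`, `ε_k + ε_l` (`k < l`) and `2 ε_k` of type `C_p`. -/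
def IsPositiveRoot (a : Fin p → ℤ) : Prop :=
  (∃ k l, k < l ∧ (a = Pi.single k 1 - Pi.single l 1 ∨ a = Pi.single k 1 + Pi.single l 1)) ∨
    ∃ k, a = Pi.single k 2

/-- `M` is an irreducible complex `𝔰𝔭(p)`-module with highest weight `l`: it contains a nonzero
vector of weight `l` that is annihilated by all positive root vectors. -/
def IsIrreducibleWithHighestWeight (Q : HypercomplexStructure V) (e : Fin p → V) (M : Type*)
    [AddCommGroup M] [Module ℂ M] [LieRingModule (SpC Q) M] (l : Fin p → ℤ) : Prop :=
  LieModule.IsIrreducible ℂ (SpC Q) M ∧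
    ∃ m : M, m ≠ 0 ∧ HasWeight Q e l m ∧
      ∀ (a : Fin p → ℤ) (x : SpC Q), IsPositiveRoot a → HasWeight Q e a x → ⁅x, m⁆ = 0

/-- The weight `(1, …, 1, 0, …, 0)` with `t` entries equal to `1`. -/
def fundamentalWeight (p : ℕ) (t : ℤ) : Fin p → ℤ := fun k => if ((k : ℕ) : ℤ) < t then 1 else 0

/-- `M ≃ U_t`, the irreducible `𝔰𝔭(p)`-module with highest weight `(1, …, 1, 0, …, 0)` (`t`
entries `1`).  There is no such module unless `0 ≤ t ≤ p`. -/
def IsFundamental (Q : HypercomplexStructure V) (e : Fin p → V) (t : ℤ) (M : Type*)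
    [AddCommGroup M] [Module ℂ M] [LieRingModule (SpC Q) M] : Prop :=
  0 ≤ t ∧ t ≤ p ∧ IsIrreducibleWithHighestWeight Q e M (fundamentalWeight p t)

end Weights

section Gradients

variable {p : ℕ} (U : Type*) [AddCommGroup U] [Module ℂ U]

/-- `V_c = W₁ ⊕ W₂` is a decomposition into irreducible `𝔰𝔭(p)`-submodules. -/
structure IsIrreducibleDecomposition (Q : HypercomplexStructure V)
    (W : Fin 2 → LieSubmodule ℂ (SpC Q) (Vc V)) : Prop where
  irreducible : ∀ i, LieModule.IsIrreducible ℂ (SpC Q) (W i)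
  isCompl : IsCompl (W 0) (W 1)

/-- The submodule `W ⊗ U` of `V_c ⊗ U`. -/
def tensorSubmodule (Q : HypercomplexStructure V) [LieRingModule (SpC Q) U]
    [LieModule ℂ (SpC Q) U] (W : LieSubmodule ℂ (SpC Q) (Vc V)) :
    LieSubmodule ℂ (SpC Q) (Vc V ⊗[ℂ] U) :=
  (TensorProduct.LieModule.map W.incl (LieModuleHom.id : U →ₗ⁅ℂ,SpC Q⁆ U)).range

/-- The irreducible summand of `W ⊗ U` that is isomorphic to `U_t`.  For irreducible `W ⊆ V_c`
and `U = U_s`, the module `W ⊗ U` is multiplicity free, so that the supremum is taken over at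
most one submodule; it is zero if `U_t` does not occur (or does not exist). -/
def summand (Q : HypercomplexStructure V) (e : Fin p → V) [LieRingModule (SpC Q) U]
    [LieModule ℂ (SpC Q) U] (W : LieSubmodule ℂ (SpC Q) (Vc V)) (t : ℤ) :
    LieSubmodule ℂ (SpC Q) (Vc V ⊗[ℂ] U) :=
  sSup {N | N ≤ tensorSubmodule U Q W ∧ IsFundamental Q e t N}

/-- The sum of the other irreducible summands of `W ⊗ U`, those not isomorphic to `U_t`. -/
def otherSummands (Q : HypercomplexStructure V) (e : Fin p → V) [LieRingModule (SpC Q) U]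
    [LieModule ℂ (SpC Q) U] (W : LieSubmodule ℂ (SpC Q) (Vc V)) (t : ℤ) :
    LieSubmodule ℂ (SpC Q) (Vc V ⊗[ℂ] U) :=
  sSup {N | N ≤ tensorSubmodule U Q W ∧ LieModule.IsIrreducible ℂ (SpC Q) N ∧
    ¬ IsFundamental Q e t N}

open Classical in
/-- For a decomposition `V_c = W ⊕ W'`, the invariant projection of
`V_c ⊗ U = (W ⊗ U) ⊕ (W' ⊗ U)` onto the summand `≃ U_t` of `W ⊗ U`, along the other summands of
`W ⊗ U` and `W' ⊗ U`.  (By complete reducibility, `W ⊗ U` is the direct sum of its summand `≃ U_t`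
and the others, so that the condition in the definition holds.) -/
def summandProjection (Q : HypercomplexStructure V) (e : Fin p → V) [LieRingModule (SpC Q) U]
    [LieModule ℂ (SpC Q) U] (W W' : LieSubmodule ℂ (SpC Q) (Vc V)) (t : ℤ) :
    Module.End ℂ (Vc V ⊗[ℂ] U) :=
  if h : IsCompl (summand U Q e W t).toSubmodule
      (otherSummands U Q e W t ⊔ tensorSubmodule U Q W').toSubmodule
  then Submodule.projection _ _ h else 0

end Gradients

section Operators

variable {p : ℕ} [FiniteDimensional ℝ V] {U : Type*} [NormedAddCommGroup U] [NormedSpace ℂ U]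

/-- The gradient `∇ f (x) = ∑ₐ eₐ ⊗ ∂ₐ f (x) ∈ V_c ⊗ U`, for an orthonormal basis `(eₐ)` of `V`
(it does not depend on the basis). -/
def gradient (f : V → U) (x : V) : Vc V ⊗[ℂ] U :=
  ∑ a, ((1 : ℂ) ⊗ₜ[ℝ] stdOrthonormalBasis ℝ V a) ⊗ₜ[ℂ]
    fderiv ℝ f x (stdOrthonormalBasis ℝ V a)

/-- The Stein-Weiss gradient `D_{i,±} f = π_{i,±} (∇ f)` for functions with values in `U = U_s`
and a decomposition `V_c = W 0 ⊕ W 1`.  The sign is `ε = ±1`, and `i` runs through `0`, `1`. -/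
def steinWeissGradient (Q : HypercomplexStructure V) (e : Fin p → V) [LieRingModule (SpC Q) U]
    [LieModule ℂ (SpC Q) U] (W : Fin 2 → LieSubmodule ℂ (SpC Q) (Vc V)) (s : ℕ) (i : Fin 2)
    (ε : ℤˣ) (f : V → U) (x : V) : Vc V ⊗[ℂ] U :=
  summandProjection U Q e (W i) (W (1 - i)) (s + ε) (gradient f x)

end Operators

end SteinWeiss

end

/-!
The kernels of the Stein–Weiss gradients do not depend on the decomposition `V_c = W₁ ⊕ W₂`,
because for each sign the common kernel of the two projections `π_{1,±}`, `π_{2,±}` of `V_c ⊗ U_s`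
is the sum of all irreducible submodules of `V_c ⊗ U_s` that are not isomorphic to `U_{s±1}`, a
submodule in whose definition no decomposition occurs (`forall_summandProjection_eq_zero_iff`).
Indeed, the kernel of `π_{i,±}` is the part of the other types in `W_i ⊗ U_s`, plus `W_{3-i} ⊗
U_s`; the intersection of these two kernels is the sum of the two parts of the other types; and an
irreducible submodule of `V_c ⊗ U_s` not isomorphic to `U_{s±1}` lies in this sum, since its
projections to `W_1 ⊗ U_s` and `W_2 ⊗ U_s` are zero or isomorphic to it (`inf_eq_otherPart_top`).

That `W_i ⊗ U_s` is the direct sum of its part of type `U_{s±1}` and of the part of the other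
types, so that the projections are what they are meant to be, rests on the complete reducibility
of `V_c ⊗ U_s` (`complementedLattice_tensor`). It is obtained from a unitary structure, without
integration over the group. As `𝔰𝔭(p)` acts on `V` by skew-symmetric maps, `V_c` and its tensor
powers are unitary, hence completely reducible. The frame gives weight vectors `v_1, …, v_p` of
`V_c` of weights `ε_1, …, ε_p` in one eigenspace of `I`; there a positive root vector maps `v_k`
to a combination of the `v_l` with `l < k`, so that `v_1 ∧ … ∧ v_s` is a highest weight vector of
the weight of `U_s` in a unitary module `T` (`exists_unitary_highestWeightVector`). In the
submodule `N` of `U_s × T` that is generated by the pair of the two highest weight vectors, the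
vectors of highest weight form a line (`IsHighestWeightVector.mem_span_of_hasWeight`). Therefore
`N` is mapped onto `U_s` and injectively into `T` (`exists_surjective_injective`), and `V_c ⊗ U_s`
is a quotient of the submodule `V_c ⊗ N` of the unitary module `V_c ⊗ T`.

The weight argument needs that the complexified Lie algebra is spanned by the torus elements and
by root vectors. It is spanned by the images of pairs of weight vectors under the equivariant
bilinear map `complexQuatWedge`, whose weights are sums of two weights of `V_c`, that is, zero or
roots; and the elements of weight zero are combinations of torus elements
(`mem_span_torusElement_of_hasWeight_zero`).
-/

noncomputable section

namespace SteinWeiss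

attribute [local instance 100] LieRing.ofAssociativeRing

/-! ### Irreducible submodules and completely reducible Lie modules -/

section Semisimple

variable {R L M M' : Type*} [CommRing R] [LieRing L] [AddCommGroup M] [Module R M]
  [LieRingModule L M] [AddCommGroup M'] [Module R M'] [LieRingModule L M']

theorem complementedLattice_of_injective (f : M →ₗ⁅R,L⁆ M') (hf : Function.Injective f)
    [ComplementedLattice (LieSubmodule R L M')] : ComplementedLattice (LieSubmodule R L M) where
  exists_isCompl N := by
    obtain ⟨C, hC⟩ := exists_isCompl (N.map f)
    refine ⟨C.comap f, ?_, ?_⟩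
    · rw [disjoint_iff, LieSubmodule.eq_bot_iff]
      rintro m ⟨hN, hm⟩
      have : f m ∈ N.map f ⊓ C := ⟨LieSubmodule.mem_map_of_mem hN, hm⟩
      rw [hC.inf_eq_bot, LieSubmodule.mem_bot] at this
      exact hf (by simpa using this)
    · rw [codisjoint_iff, eq_top_iff]
      intro m _
      have : f m ∈ N.map f ⊔ C := by rw [hC.sup_eq_top]; trivial
      rw [LieSubmodule.mem_sup] at this ⊢
      obtain ⟨y, hy, c, hc, h⟩ := this
      obtain ⟨n, hn, rfl⟩ := (LieSubmodule.mem_map _).1 hy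
      refine ⟨n, hn, m - n, ?_, by abel⟩
      rw [LieSubmodule.mem_comap, map_sub, ← h, add_sub_cancel_left]
      exact hc

theorem complementedLattice_of_surjective (f : M →ₗ⁅R,L⁆ M') (hf : Function.Surjective f)
    [ComplementedLattice (LieSubmodule R L M)] : ComplementedLattice (LieSubmodule R L M') where
  exists_isCompl N := by
    obtain ⟨C, hC⟩ := exists_isCompl (N.comap f)
    refine ⟨C.map f, ?_, ?_⟩
    · rw [disjoint_iff, LieSubmodule.eq_bot_iff]
      rintro m ⟨hN, hm⟩
      obtain ⟨c, hc, rfl⟩ := (LieSubmodule.mem_map _).1 hm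
      have : c ∈ N.comap f ⊓ C := ⟨hN, hc⟩
      rw [hC.inf_eq_bot, LieSubmodule.mem_bot] at this
      simp [this]
    · rw [codisjoint_iff, eq_top_iff]
      intro m' _
      obtain ⟨m, rfl⟩ := hf m'
      have : m ∈ N.comap f ⊔ C := by rw [hC.sup_eq_top]; trivial
      rw [LieSubmodule.mem_sup] at this ⊢
      obtain ⟨y, hy, c, hc, rfl⟩ := this
      exact ⟨f y, hy, f c, LieSubmodule.mem_map_of_mem hc, by simp⟩

theorem isAtom_iff_isIrreducible (N : LieSubmodule R L M) :
    IsAtom N ↔ LieModule.IsIrreducible R L N := by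
  constructor
  · intro h
    have : Nontrivial N := (LieSubmodule.nontrivial_iff_ne_bot R L M).2 h.1
    refine LieModule.IsIrreducible.mk fun P hP => ?_
    have hle : P.map N.incl ≤ N := by
      rintro _ ⟨x, _, rfl⟩
      exact x.2
    have h0 : P.map N.incl ≠ ⊥ := fun h0 => hP <| by
      rw [← LieSubmodule.map_bot (f := N.incl)] at h0
      exact LieSubmodule.map_injective_of_injective N.injective_incl h0
    rw [eq_top_iff]
    rintro x -
    have hx : (x : M) ∈ P.map N.incl := by
      rw [(h.le_iff_eq h0).1 hle]
      exact x.2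
    obtain ⟨y, hy, hyx⟩ := (LieSubmodule.mem_map _).1 hx
    rwa [← show y = x from Subtype.ext hyx]
  · intro h
    have : Nontrivial N := (LieSubmodule.nontrivial_iff R L N).1 h.toNontrivial
    refine ⟨(LieSubmodule.nontrivial_iff_ne_bot R L M).1 this, fun P hP => ?_⟩
    rcases h.eq_bot_or_eq_top (P.comap N.incl) with h0 | h1
    · rw [LieSubmodule.comap_incl_eq_bot, inf_eq_right.2 hP.le] at h0
      exact h0
    · exact absurd (LieSubmodule.comap_incl_eq_top.1 h1) hP.not_ge

/-- Schur's lemma. -/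
theorem bijective_of_isIrreducible (hM : LieModule.IsIrreducible R L M)
    (hM' : LieModule.IsIrreducible R L M') (f : M →ₗ⁅R,L⁆ M') {m : M} (hm : f m ≠ 0) :
    Function.Bijective f := by
  constructor
  · rw [← LieModuleHom.ker_eq_bot]
    refine (hM.eq_bot_or_eq_top _).resolve_right fun h => hm ?_
    rw [← LieModuleHom.mem_ker, h]
    trivial
  · rw [← LieModuleHom.range_eq_top]
    refine (hM'.eq_bot_or_eq_top _).resolve_left fun h => hm ?_
    rw [← LieSubmodule.mem_bot (R := R) (L := L), ← h]
    exact ⟨m, rfl⟩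

/-- The equivariant projection onto a Lie submodule along a complementary one. -/
def lieProjection (N C : LieSubmodule R L M) (h : IsCompl N C) : M →ₗ⁅R,L⁆ M where
  toLinearMap := N.toSubmodule.projection C.toSubmodule (LieSubmodule.isCompl_toSubmodule.2 h)
  map_lie' {y x} := by
    have h' := LieSubmodule.isCompl_toSubmodule.2 h
    have hx : x ∈ N ⊔ C := by rw [h.sup_eq_top]; trivial
    obtain ⟨a, ha, b, hb, rfl⟩ := (LieSubmodule.mem_sup _ _ _).1 hx
    have e1 := Submodule.projection_apply_left h' ⟨a, ha⟩
    have e2 := Submodule.projection_apply_right h' ⟨b, hb⟩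
    have e3 := Submodule.projection_apply_left h' ⟨_, N.lie_mem (x := y) ha⟩
    have e4 := Submodule.projection_apply_right h' ⟨_, C.lie_mem (x := y) hb⟩
    simp only at e1 e2 e3 e4
    simp [e1, e2, e3, e4]

section

variable {N C : LieSubmodule R L M} (h : IsCompl N C)

theorem lieProjection_mem (x : M) : lieProjection N C h x ∈ N :=
  Submodule.projection_apply_mem (LieSubmodule.isCompl_toSubmodule.2 h) x

theorem lieProjection_of_mem_left {x : M} (hx : x ∈ N) : lieProjection N C h x = x :=
  Submodule.projection_apply_left (LieSubmodule.isCompl_toSubmodule.2 h) ⟨x, hx⟩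

theorem lieProjection_of_mem_right {x : M} (hx : x ∈ C) : lieProjection N C h x = 0 :=
  Submodule.projection_apply_right (LieSubmodule.isCompl_toSubmodule.2 h) ⟨x, hx⟩

theorem lieProjection_add (x : M) :
    lieProjection N C h x + lieProjection C N h.symm x = x :=
  Submodule.projection_add_projection_eq_self (LieSubmodule.isCompl_toSubmodule.2 h) x

end

/-- In a completely reducible module, an irreducible submodule of a sum of irreducible submodules
is isomorphic to one of them. -/
theorem exists_equiv_of_le_sSup [ComplementedLattice (LieSubmodule R L M)]
    {N : LieSubmodule R L M} (hN : LieModule.IsIrreducible R L N) {S : Set (LieSubmodule R L M)}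
    (hS : ∀ P ∈ S, LieModule.IsIrreducible R L P) (h : N ≤ sSup S) :
    ∃ P ∈ S, ∃ f : N →ₗ⁅R,L⁆ P, Function.Bijective f := by
  obtain ⟨C, hC⟩ := exists_isCompl N
  have hN0 : N ≠ ⊥ := ((isAtom_iff_isIrreducible N).2 hN).1
  -- some member of `S` is not killed by the projection to `N`
  obtain ⟨P, hP, x, hx, hx0⟩ : ∃ P ∈ S, ∃ x ∈ P, lieProjection N C hC x ≠ 0 := by
    by_contra! h0
    refine hN0 ((LieSubmodule.eq_bot_iff N).2 fun n hn => ?_)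
    have hle : sSup S ≤ (lieProjection N C hC).ker :=
      sSup_le fun P hP x hx => LieModuleHom.mem_ker.2 (h0 P hP x hx)
    rw [← lieProjection_of_mem_left hC hn]
    exact hle (h hn)
  let g : P →ₗ⁅R,L⁆ N :=
    ((lieProjection N C hC).comp P.incl).codRestrict N fun m => lieProjection_mem hC _
  have hg : Function.Bijective g := bijective_of_isIrreducible (hS P hP) hN g (m := ⟨x, hx⟩)
    fun h0 => hx0 (congrArg Subtype.val h0)
  let e := LinearEquiv.ofBijective (g : P →ₗ[R] N) hg
  refine ⟨P, hP, { e.symm.toLinearMap with map_lie' := ?_ }, e.symm.bijective⟩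
  intro y n
  apply hg.1
  have h1 : ∀ n, g (e.symm n) = n := e.apply_symm_apply
  change g (e.symm ⁅y, n⁆) = g ⁅y, e.symm n⁆
  rw [LieModuleHom.map_lie, h1, h1]

end Semisimple

/-! ### The part of a given type and the part of the other types -/

section Isotypic

variable {R L M : Type*} [CommRing R] [LieRing L] [AddCommGroup M] [Module R M]
  [LieRingModule L M]

/-- The sum of the submodules of `W` that satisfy `T`. -/
def typePart (T : LieSubmodule R L M → Prop) (W : LieSubmodule R L M) : LieSubmodule R L M :=
  sSup {N | N ≤ W ∧ T N}

/-- The sum of the irreducible submodules of `W` that do not satisfy `T`. -/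
def otherPart (T : LieSubmodule R L M → Prop) (W : LieSubmodule R L M) : LieSubmodule R L M :=
  sSup {N | N ≤ W ∧ LieModule.IsIrreducible R L N ∧ ¬ T N}

/-- `T` is a property of isomorphism classes of irreducible submodules. -/
structure IsIrreducibleType (T : LieSubmodule R L M → Prop) : Prop where
  irreducible : ∀ N, T N → LieModule.IsIrreducible R L N
  congr : ∀ (N P : LieSubmodule R L M) (f : N →ₗ⁅R,L⁆ P), Function.Bijective f → (T N ↔ T P)

variable {T : LieSubmodule R L M → Prop} {W W' : LieSubmodule R L M}

theorem typePart_le : typePart T W ≤ W := sSup_le fun _ h => h.1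

theorem otherPart_le : otherPart T W ≤ W := sSup_le fun _ h => h.1

theorem otherPart_mono (h : W ≤ W') : otherPart T W ≤ otherPart T W' :=
  sSup_le_sSup fun _ hN => ⟨hN.1.trans h, hN.2⟩

/-- The image of an irreducible submodule not of type `T` under the projection to `W` is zero, or
again irreducible and not of type `T`. -/
theorem map_lieProjection_le_otherPart (hT : IsIrreducibleType T) (h : IsCompl W W')
    {N : LieSubmodule R L M} (hN : LieModule.IsIrreducible R L N) (hNT : ¬ T N) :
    N.map (lieProjection W W' h) ≤ otherPart T W := by
  by_cases h0 : ∀ n ∈ N, lieProjection W W' h n = 0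
  · rintro _ ⟨n, hn, rfl⟩
    exact (h0 n hn).symm ▸ zero_mem _
  push Not at h0
  obtain ⟨n, hn, hn0⟩ := h0
  let f : N →ₗ⁅R,L⁆ (N.map (lieProjection W W' h)) :=
    ((lieProjection W W' h).comp N.incl).codRestrict _ fun m =>
      LieSubmodule.mem_map_of_mem m.2
  have hinj : Function.Injective f := by
    rw [← LieModuleHom.ker_eq_bot]
    refine (hN.eq_bot_or_eq_top _).resolve_right fun h => hn0 ?_
    have : f ⟨n, hn⟩ = 0 := by rw [← LieModuleHom.mem_ker, h]; trivial
    exact congrArg Subtype.val this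
  have hsurj : Function.Surjective f := by
    rintro ⟨_, m, hm, rfl⟩
    exact ⟨⟨m, hm⟩, rfl⟩
  have hirr : LieModule.IsIrreducible R L (N.map (lieProjection W W' h)) := by
    have : Nontrivial (N.map (lieProjection W W' h)) :=
      ⟨f ⟨n, hn⟩, 0, fun h0 => hn0 (congrArg Subtype.val h0)⟩
    refine LieModule.IsIrreducible.mk fun P hP => ?_
    rcases hN.eq_bot_or_eq_top (P.comap f) with h0 | h1
    · refine absurd ((LieSubmodule.eq_bot_iff P).2 fun y hy => ?_) hP
      obtain ⟨x, rfl⟩ := hsurj y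
      have : x ∈ P.comap f := hy
      rw [h0, LieSubmodule.mem_bot] at this
      rw [this, map_zero]
    · rw [eq_top_iff]
      rintro y -
      obtain ⟨x, rfl⟩ := hsurj y
      have : x ∈ P.comap f := by rw [h1]; trivial
      exact this
  refine le_sSup ⟨?_, hirr, fun hP => hNT ((hT.congr _ _ f ⟨hinj, hsurj⟩).2 hP)⟩
  rintro _ ⟨m, -, rfl⟩
  exact lieProjection_mem h m

theorem otherPart_top_le (hT : IsIrreducibleType T) (h : IsCompl W W') :
    otherPart T ⊤ ≤ otherPart T W ⊔ W' := by
  refine sSup_le fun N hN n hn => ?_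
  rw [LieSubmodule.mem_sup]
  exact ⟨_, map_lieProjection_le_otherPart hT h hN.2.1 hN.2.2 (LieSubmodule.mem_map_of_mem hn), _,
    lieProjection_mem h.symm n, lieProjection_add h n⟩

/-- The intersection of the kernels of the projections to the parts of type `T` of two
complementary submodules does not depend on these submodules. -/
theorem inf_eq_otherPart_top (hT : IsIrreducibleType T) (h : IsCompl W W') :
    (otherPart T W ⊔ W') ⊓ (otherPart T W' ⊔ W) = otherPart T ⊤ := by
  refine le_antisymm ?_ (le_inf (otherPart_top_le hT h) (otherPart_top_le hT h.symm))
  rw [sup_inf_assoc_of_le _ (otherPart_le.trans le_sup_right), inf_comm W',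
    sup_inf_assoc_of_le _ otherPart_le, h.disjoint.eq_bot, sup_bot_eq]
  exact sup_le (otherPart_mono le_top) (otherPart_mono le_top)

variable [ComplementedLattice (LieSubmodule R L M)]

theorem typePart_sup_otherPart : typePart T W ⊔ otherPart T W = W := by
  refine le_antisymm (sup_le typePart_le otherPart_le) ?_
  conv_lhs => rw [← sSup_atoms_le_eq W]
  refine sSup_le fun N hN => ?_
  by_cases h : T N
  · exact (le_sSup (show N ∈ {N | N ≤ W ∧ T N} from ⟨hN.2, h⟩)).trans le_sup_left
  · exact (le_sSup (show N ∈ {N | N ≤ W ∧ LieModule.IsIrreducible R L N ∧ ¬ T N} from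
      ⟨hN.2, (isAtom_iff_isIrreducible N).1 hN.1, h⟩)).trans le_sup_right

theorem disjoint_typePart_otherPart (hT : IsIrreducibleType T) :
    Disjoint (typePart T W) (otherPart T W) := by
  rw [disjoint_iff]
  by_contra h0
  obtain ⟨N, hN, hle⟩ := (IsAtomic.eq_bot_or_exists_atom_le _).resolve_left h0
  have hN' := (isAtom_iff_isIrreducible N).1 hN
  obtain ⟨P, hP, f, hf⟩ := exists_equiv_of_le_sSup hN' (fun P hP => hT.irreducible P hP.2)
    (hle.trans inf_le_left)
  obtain ⟨P', hP', f', hf'⟩ := exists_equiv_of_le_sSup hN' (fun P hP => hP.2.1)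
    (hle.trans inf_le_right)
  exact hP'.2.2 ((hT.congr _ _ f' hf').1 ((hT.congr _ _ f hf).2 hP.2))

theorem isCompl_typePart (hT : IsIrreducibleType T) (h : IsCompl W W') :
    IsCompl (typePart T W) (otherPart T W ⊔ W') := by
  constructor
  · exact (disjoint_typePart_otherPart hT).disjoint_sup_right_of_disjoint_sup_left
      (by rw [typePart_sup_otherPart]; exact h.disjoint)
  · rw [codisjoint_iff, ← sup_assoc, typePart_sup_otherPart, h.sup_eq_top]

end Isotypic

/-! ### Kernels of the Stein–Weiss gradients -/

section Kernels

variable {V : Type*} [NormedAddCommGroup V] [InnerProductSpace ℝ V]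
  {Q : HypercomplexStructure V} {p : ℕ} {e : Fin p → V}

theorem hasWeight_map_iff {M M' : Type*} [AddCommGroup M] [Module ℂ M] [LieRingModule (SpC Q) M]
    [AddCommGroup M'] [Module ℂ M'] [LieRingModule (SpC Q) M'] (f : M →ₗ⁅ℂ,SpC Q⁆ M')
    (hf : Function.Injective f) {l : Fin p → ℤ} {m : M} :
    HasWeight Q e l (f m) ↔ HasWeight Q e l m := by
  refine forall_congr' fun k => ?_
  rw [← LieModuleHom.map_lie, ← map_smul]
  exact hf.eq_iff

theorem isFundamental_congr {M M' : Type*} [AddCommGroup M] [Module ℂ M]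
    [LieRingModule (SpC Q) M] [AddCommGroup M'] [Module ℂ M'] [LieRingModule (SpC Q) M']
    (f : M →ₗ⁅ℂ,SpC Q⁆ M') (hf : Function.Bijective f) {t : ℤ} :
    IsFundamental Q e t M ↔ IsFundamental Q e t M' := by
  have key : ∀ x m, ⁅x, f m⁆ = 0 ↔ ⁅x, m⁆ = 0 := fun x m => by
    rw [← LieModuleHom.map_lie, map_eq_zero_iff f hf.1]
  let E : M ≃ₗ⁅ℂ,SpC Q⁆ M' :=
    { f with
      invFun := (Equiv.ofBijective f hf).symm
      left_inv := (Equiv.ofBijective f hf).left_inv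
      right_inv := (Equiv.ofBijective f hf).right_inv }
  refine and_congr_right fun _ => and_congr_right fun _ =>
    and_congr (LieSubmodule.orderIsoMapComap E).isSimpleOrder_iff ?_
  constructor
  · rintro ⟨m, h0, hm, h⟩
    exact ⟨f m, (map_ne_zero_iff f hf.1).2 h0, (hasWeight_map_iff f hf.1).2 hm,
      fun a x ha hx => (key x m).2 (h a x ha hx)⟩
  · rintro ⟨m', h0, hm, h⟩
    obtain ⟨m, rfl⟩ := hf.2 m'
    exact ⟨m, (map_ne_zero_iff f hf.1).1 h0, (hasWeight_map_iff f hf.1).1 hm,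
      fun a x ha hx => (key x m).1 (h a x ha hx)⟩

theorem isIrreducibleType_isFundamental {M : Type*} [AddCommGroup M] [Module ℂ M]
    [LieRingModule (SpC Q) M] (t : ℤ) :
    IsIrreducibleType fun N : LieSubmodule ℂ (SpC Q) M => IsFundamental Q e t N where
  irreducible _ h := h.2.2.1
  congr _ _ f hf := isFundamental_congr f hf

variable {U : Type*} [AddCommGroup U] [Module ℂ U] [LieRingModule (SpC Q) U]
  [LieModule ℂ (SpC Q) U]

theorem isCompl_tensorSubmodule {W W' : LieSubmodule ℂ (SpC Q) (Vc V)} (h : IsCompl W W') :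
    IsCompl (tensorSubmodule U Q W) (tensorSubmodule U Q W') := by
  constructor
  · rw [disjoint_iff, LieSubmodule.eq_bot_iff]
    rintro x ⟨⟨y, rfl⟩, ⟨z, hz⟩⟩
    -- the projection to `W`, tensored with the identity, fixes `W ⊗ U` and kills `W' ⊗ U`
    let P := TensorProduct.map (lieProjection W W' h : Vc V →ₗ[ℂ] Vc V) (LinearMap.id : U →ₗ[ℂ] U)
    have h1 : P ∘ₗ TensorProduct.map (W.incl : W →ₗ[ℂ] Vc V) LinearMap.id =
        TensorProduct.map (W.incl : W →ₗ[ℂ] Vc V) LinearMap.id := by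
      refine TensorProduct.ext' fun w u => ?_
      exact congrArg (· ⊗ₜ[ℂ] u) (lieProjection_of_mem_left h w.2)
    have h2 : P ∘ₗ TensorProduct.map (W'.incl : W' →ₗ[ℂ] Vc V) LinearMap.id = 0 := by
      refine TensorProduct.ext' fun w u => ?_
      exact (congrArg (· ⊗ₜ[ℂ] u) (lieProjection_of_mem_right h w.2)).trans
        (TensorProduct.zero_tmul _ _)
    have e1 := LinearMap.congr_fun h1 y
    have e2 := LinearMap.congr_fun h2 z
    exact e1.symm.trans ((congrArg P hz.symm).trans e2)
  · rw [codisjoint_iff, eq_top_iff]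
    rintro x -
    induction x using TensorProduct.induction_on with
    | zero => exact zero_mem _
    | add x y hx hy => exact add_mem hx hy
    | tmul v u =>
      rw [← lieProjection_add h v, TensorProduct.add_tmul]
      have h1 : lieProjection W W' h v ⊗ₜ[ℂ] u ∈ tensorSubmodule U Q W :=
        ⟨(⟨_, lieProjection_mem h v⟩ : W) ⊗ₜ u, rfl⟩
      have h2 : lieProjection W' W h.symm v ⊗ₜ[ℂ] u ∈ tensorSubmodule U Q W' :=
        ⟨(⟨_, lieProjection_mem h.symm v⟩ : W') ⊗ₜ u, rfl⟩
      exact add_mem (le_sup_left (a := tensorSubmodule U Q W) h1)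
        (le_sup_right (b := tensorSubmodule U Q W') h2)

variable [ComplementedLattice (LieSubmodule ℂ (SpC Q) (Vc V ⊗[ℂ] U))]

theorem summandProjection_eq_zero_iff {W W' : LieSubmodule ℂ (SpC Q) (Vc V)} (h : IsCompl W W')
    (t : ℤ) (x : Vc V ⊗[ℂ] U) :
    summandProjection U Q e W W' t x = 0 ↔
      x ∈ otherSummands U Q e W t ⊔ tensorSubmodule U Q W' := by
  have hC : IsCompl (summand U Q e W t) (otherSummands U Q e W t ⊔ tensorSubmodule U Q W') :=
    isCompl_typePart (isIrreducibleType_isFundamental t) (isCompl_tensorSubmodule h)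
  rw [summandProjection, dif_pos (LieSubmodule.isCompl_toSubmodule.2 hC),
    Submodule.projection_apply_eq_zero_iff, LieSubmodule.mem_toSubmodule]

/-- Both projections `π_{i,±}` kill exactly the sum of all irreducible submodules of `V_c ⊗ U` that
are not isomorphic to `U_t`, whatever the decomposition. -/
theorem forall_summandProjection_eq_zero_iff {W : Fin 2 → LieSubmodule ℂ (SpC Q) (Vc V)}
    (hW : IsIrreducibleDecomposition Q W) (t : ℤ) (x : Vc V ⊗[ℂ] U) :
    (∀ i, summandProjection U Q e (W i) (W (1 - i)) t x = 0) ↔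
      x ∈ otherPart (fun N : LieSubmodule ℂ (SpC Q) (Vc V ⊗[ℂ] U) => IsFundamental Q e t N) ⊤ := by
  rw [Fin.forall_fin_two, sub_zero, sub_self, summandProjection_eq_zero_iff hW.isCompl,
    summandProjection_eq_zero_iff hW.isCompl.symm, ← LieSubmodule.mem_inf]
  exact iff_of_eq (congrArg (x ∈ ·) (inf_eq_otherPart_top (isIrreducibleType_isFundamental t)
    (isCompl_tensorSubmodule hW.isCompl)))

end Kernels

/-! ### Cyclic modules generated by a highest weight vector -/

section HighestWeight

variable {K L M : Type*} [Field K] [LieRing L] [AddCommGroup M] [Module K M]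
  [LieRingModule L M]

/-- The span of the words of length at most `n` in the operators from `S`, applied to `x`. -/
def wordSpan (S : Set L) (x : M) : ℕ → Submodule K M
  | 0 => Submodule.span K {x}
  | n + 1 => wordSpan S x n ⊔ Submodule.span K {m | ∃ f ∈ S, ∃ w ∈ wordSpan S x n, ⁅f, w⁆ = m}

theorem wordSpan_mono (S : Set L) (x : M) : Monotone (wordSpan (K := K) S x) :=
  monotone_nat_of_le_succ fun _ => le_sup_left

variable [LieAlgebra K L] [LieModule K L M]

theorem lie_mem_wordSpan_succ {S : Set L} {x : M} {n : ℕ} {f : L} (hf : f ∈ Submodule.span K S)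
    {w : M} (hw : w ∈ wordSpan (K := K) S x n) : ⁅f, w⁆ ∈ wordSpan (K := K) S x (n + 1) := by
  induction hf using Submodule.span_induction with
  | mem f hf => exact Submodule.mem_sup_right (Submodule.subset_span ⟨f, hf, w, hw, rfl⟩)
  | zero => rw [zero_lie]; exact zero_mem _
  | add f g _ _ h1 h2 => rw [add_lie]; exact add_mem h1 h2
  | smul c f _ h => rw [smul_lie]; exact Submodule.smul_mem _ _ h

/-- Operators that scale `x` do not lengthen words. -/
theorem lie_mem_wordSpan {S : Set L} {B : Submodule K L} (hBS : B ⊔ Submodule.span K S = ⊤)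
    {x : M} (hx : ∀ b ∈ B, ⁅b, x⁆ ∈ Submodule.span K {x}) (n : ℕ) :
    ∀ b ∈ B, ∀ w ∈ wordSpan (K := K) S x n, ⁅b, w⁆ ∈ wordSpan (K := K) S x n := by
  induction n with
  | zero =>
    intro b hb w hw
    obtain ⟨c, rfl⟩ := Submodule.mem_span_singleton.1 hw
    rw [lie_smul]
    exact Submodule.smul_mem _ _ (hx b hb)
  | succ n ih =>
    intro b hb w hw
    obtain ⟨w1, hw1, w2, hw2, rfl⟩ := Submodule.mem_sup.1 hw
    rw [lie_add]
    refine add_mem (wordSpan_mono S x n.le_succ (ih b hb w1 hw1)) ?_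
    clear hw
    induction hw2 using Submodule.span_induction with
    | mem m hm =>
      obtain ⟨f, hf, w, hw, rfl⟩ := hm
      have hbf : ⁅b, f⁆ ∈ B ⊔ Submodule.span K S := hBS ▸ Submodule.mem_top
      obtain ⟨b', hb', g, hg, hbg⟩ := Submodule.mem_sup.1 hbf
      rw [leibniz_lie, ← hbg, add_lie]
      exact add_mem (add_mem (wordSpan_mono S x n.le_succ (ih b' hb' w hw))
        (lie_mem_wordSpan_succ hg hw))
        (lie_mem_wordSpan_succ (Submodule.subset_span hf) (ih b hb w hw))
    | zero => rw [lie_zero]; exact zero_mem _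
    | add m m' _ _ h1 h2 => rw [lie_add]; exact add_mem h1 h2
    | smul c m _ h => rw [lie_smul]; exact Submodule.smul_mem _ _ h

theorem exists_mem_wordSpan_of_mem_lieSpan {S : Set L} {B : Submodule K L}
    (hBS : B ⊔ Submodule.span K S = ⊤) {x : M} (hx : ∀ b ∈ B, ⁅b, x⁆ ∈ Submodule.span K {x})
    {y : M} (hy : y ∈ LieSubmodule.lieSpan K L {x}) : ∃ n, y ∈ wordSpan (K := K) S x n := by
  let N : LieSubmodule K L M :=
    { (⨆ n, wordSpan (K := K) S x n : Submodule K M) with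
      lie_mem := by
        intro a m hm
        obtain ⟨n, hn⟩ := (Submodule.mem_iSup_of_directed _
          (wordSpan_mono S x).directed_le).1 hm
        have ha : a ∈ B ⊔ Submodule.span K S := hBS ▸ Submodule.mem_top
        obtain ⟨b, hb, f, hf, rfl⟩ := Submodule.mem_sup.1 ha
        rw [add_lie]
        exact add_mem (Submodule.mem_iSup_of_mem n (lie_mem_wordSpan hBS hx n b hb m hn))
          (Submodule.mem_iSup_of_mem (n + 1) (lie_mem_wordSpan_succ hf hn)) }
  have hN : LieSubmodule.lieSpan K L {x} ≤ N := by
    rw [LieSubmodule.lieSpan_le, Set.singleton_subset_iff]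
    exact Submodule.mem_iSup_of_mem (p := wordSpan (K := K) S x) 0
      (Submodule.mem_span_singleton_self x)
  exact (Submodule.mem_iSup_of_directed _ (wordSpan_mono S x).directed_le).1 (hN hy)

/-- Let `L` be spanned by operators that scale `x` and by operators that lower the eigenvalue of
`h`.  Then the eigenspace of `h` through `x` in the module generated by `x` is a line. -/
theorem mem_span_singleton_of_mem_lieSpan [CharZero K] {S : Set L} {B : Submodule K L}
    (hBS : B ⊔ Submodule.span K S = ⊤) {x : M} (hx : ∀ b ∈ B, ⁅b, x⁆ ∈ Submodule.span K {x})
    {h : L} (hS : ∀ f ∈ S, ∃ d : ℤ, d < 0 ∧ ⁅h, f⁆ = (d : K) • f) {c : ℤ}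
    (hc : ⁅h, x⁆ = (c : K) • x) {y : M} (hy : y ∈ LieSubmodule.lieSpan K L {x})
    (hyc : ⁅h, y⁆ = (c : K) • y) : y ∈ Submodule.span K {x} := by
  let T := LieModule.toEnd K L M h
  -- the sum of the eigenspaces for smaller eigenvalues
  let low : Submodule K M := ⨆ j : {j : ℤ // j < c}, T.eigenspace (j : ℤ)
  have lower : ∀ f ∈ S, ∀ (j : ℤ), j ≤ c → ∀ m ∈ T.eigenspace (j : K), ⁅f, m⁆ ∈ low := by
    intro f hf j hj m hm
    obtain ⟨d, hd, hfd⟩ := hS f hf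
    refine Submodule.mem_iSup_of_mem ⟨d + j, by omega⟩ (Module.End.mem_eigenspace_iff.2 ?_)
    have hm' : ⁅h, m⁆ = (j : K) • m := Module.End.mem_eigenspace_iff.1 hm
    change ⁅h, ⁅f, m⁆⁆ = _
    rw [leibniz_lie, hfd, hm', smul_lie, lie_smul, ← add_smul]
    push_cast
    rfl
  have hx' : x ∈ T.eigenspace (c : K) := Module.End.mem_eigenspace_iff.2 hc
  have hG : ∀ f ∈ S, ∀ m ∈ Submodule.span K {x} ⊔ low, ⁅f, m⁆ ∈ low := by
    intro f hf m hm
    obtain ⟨a, ha, b, hb, rfl⟩ := Submodule.mem_sup.1 hm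
    obtain ⟨r, rfl⟩ := Submodule.mem_span_singleton.1 ha
    rw [lie_add, lie_smul]
    refine add_mem (Submodule.smul_mem _ _ (lower f hf c le_rfl x hx')) ?_
    clear hm
    induction hb using Submodule.iSup_induction' with
    | mem j m hm => exact lower f hf j j.2.le m hm
    | zero => rw [lie_zero]; exact zero_mem _
    | add m m' _ _ h1 h2 => rw [lie_add]; exact add_mem h1 h2
  have hF : ∀ n, wordSpan (K := K) S x n ≤ Submodule.span K {x} ⊔ low := by
    intro n
    induction n with
    | zero => exact le_sup_left
    | succ n ih =>
      refine sup_le ih (Submodule.span_le.2 ?_)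
      rintro _ ⟨f, hf, w, hw, rfl⟩
      exact Submodule.mem_sup_right (hG f hf w (ih hw))
  obtain ⟨n, hn⟩ := exists_mem_wordSpan_of_mem_lieSpan hBS hx hy
  obtain ⟨a, ha, b, hb, rfl⟩ := Submodule.mem_sup.1 (hF n hn)
  have hac : a ∈ T.eigenspace (c : K) :=
    (Submodule.span_singleton_le_iff_mem _ _).2 hx' ha
  have hbc : b ∈ T.eigenspace (c : K) := by
    have := sub_mem (Module.End.mem_eigenspace_iff.2 hyc : a + b ∈ T.eigenspace (c : K)) hac
    rwa [add_sub_cancel_left] at this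
  have hb0 : b ∈ (⊥ : Submodule K M) := by
    rw [← (Module.End.eigenspaces_iSupIndep T (c : K)).eq_bot]
    refine ⟨hbc, ?_⟩
    refine (iSup_le fun j => ?_ : low ≤ _) hb
    exact le_iSup₂_of_le (f := fun (j : K) (_ : j ≠ c) => T.eigenspace j) ((j : ℤ) : K)
      (by exact_mod_cast j.2.ne) le_rfl
  rw [(Submodule.mem_bot K).1 hb0, add_zero]
  exact ha

end HighestWeight

/-! ### Unitary modules -/

section Unitary

variable {L : Type*} [LieRing L] [LieAlgebra ℂ L] {M N : Type*} [AddCommGroup M] [Module ℂ M]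
  [LieRingModule L M] [LieModule ℂ L M] [AddCommGroup N] [Module ℂ N]
  [LieRingModule L N] [LieModule ℂ L N]

variable (M) in
/-- `M` has a finite basis in which the elements of `S` act by skew-Hermitian matrices. -/
def IsUnitary (S : Set L) : Prop :=
  ∃ (ι : Type) (_ : Fintype ι) (b : Module.Basis ι ℂ M),
    ∀ a ∈ S, ∀ i j, b.repr ⁅a, b j⁆ i = -star (b.repr ⁅a, b i⁆ j)

/-- The orthogonal complement of a submodule of a unitary module is a submodule. -/
theorem IsUnitary.complementedLattice {S : Set L} (hS : Submodule.span ℂ S = ⊤)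
    (h : IsUnitary M S) : ComplementedLattice (LieSubmodule ℂ L M) := by
  obtain ⟨ι, _, b, hb⟩ := h
  let e : M ≃ₗ[ℂ] EuclideanSpace ℂ ι := b.equivFun ≪≫ₗ (WithLp.linearEquiv 2 ℂ (ι → ℂ)).symm
  have he : ∀ m i, e m i = b.repr m i := fun m i => rfl
  have hskew : ∀ a ∈ S, ∀ x y : M, inner ℂ (e ⁅a, x⁆) (e y) = -inner ℂ (e x) (e ⁅a, y⁆) := by
    classical
    intro a ha x y
    induction b.mem_span x using Submodule.span_induction with
    | zero => simp
    | add x x' _ _ h1 h2 => rw [lie_add, map_add, map_add, inner_add_left, inner_add_left, h1, h2,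
        neg_add]
    | smul c x _ h => rw [lie_smul, map_smul, map_smul, inner_smul_left, inner_smul_left, h,
        mul_neg]
    | mem x hx =>
      obtain ⟨i, rfl⟩ := hx
      induction b.mem_span y using Submodule.span_induction with
      | zero => simp
      | add x x' _ _ h1 h2 => rw [lie_add, map_add, map_add, inner_add_right, inner_add_right, h1,
          h2, neg_add]
      | smul c x _ h => rw [lie_smul, map_smul, map_smul, inner_smul_right, inner_smul_right, h,
          mul_neg]
      | mem y hy =>
        obtain ⟨j, rfl⟩ := hy
        simp only [PiLp.inner_apply, he, b.repr_self]
        rw [Finset.sum_eq_single j, Finset.sum_eq_single i]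
        · simp [hb a ha i j]
        · intro k _ hk
          simp [Finsupp.single_eq_of_ne hk]
        · simp
        · intro k _ hk
          simp [Finsupp.single_eq_of_ne hk]
        · simp
  refine ⟨fun P => ?_⟩
  let P' : Submodule ℂ (EuclideanSpace ℂ ι) := P.toSubmodule.map (e : M →ₗ[ℂ] EuclideanSpace ℂ ι)
  let D : Submodule ℂ M := P'ᗮ.comap (e : M →ₗ[ℂ] EuclideanSpace ℂ ι)
  let C : LieSubmodule ℂ L M :=
    { D with
      lie_mem := by
        intro x m (hm : m ∈ D)
        change ⁅x, m⁆ ∈ D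
        have hx : x ∈ Submodule.span ℂ S := hS ▸ Submodule.mem_top
        induction hx using Submodule.span_induction with
        | zero => rw [zero_lie]; exact zero_mem _
        | add x y _ _ h1 h2 => rw [add_lie]; exact add_mem h1 h2
        | smul c x _ h => rw [smul_lie]; exact Submodule.smul_mem _ _ h
        | mem a ha =>
          refine (Submodule.mem_orthogonal _ _).2 ?_
          rintro _ ⟨n, hn, rfl⟩
          have h1 := (Submodule.mem_orthogonal _ _).1 hm _
            (Submodule.mem_map_of_mem (P.lie_mem (x := a) hn))
          have h2 := hskew a ha n m
          change inner ℂ (e ⁅a, n⁆) (e m) = 0 at h1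
          rw [h1, eq_comm, neg_eq_zero] at h2
          exact h2 }
  refine ⟨C, LieSubmodule.isCompl_toSubmodule.1 ?_⟩
  change IsCompl P.toSubmodule D
  rw [(Submodule.orderIsoMapComap e).isCompl_iff]
  have h1 : Submodule.orderIsoMapComap e D = P'ᗮ :=
    Submodule.map_comap_eq_of_surjective e.surjective _
  rw [h1]
  exact Submodule.isCompl_orthogonal P'

theorem IsUnitary.tensorProduct {S : Set L} (hM : IsUnitary M S) (hN : IsUnitary N S) :
    IsUnitary (M ⊗[ℂ] N) S := by
  classical
  obtain ⟨ι, _, b, hb⟩ := hM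
  obtain ⟨κ, _, c, hc⟩ := hN
  refine ⟨ι × κ, inferInstance, b.tensorProduct c, ?_⟩
  rintro a ha ⟨i, k⟩ ⟨j, l⟩
  simp only [Module.Basis.tensorProduct_apply, TensorProduct.LieModule.lie_tmul_right, map_add,
    Finsupp.add_apply, Module.Basis.tensorProduct_repr_tmul_apply, Module.Basis.repr_self,
    hb a ha i j, hc a ha k l, Finsupp.single_apply, smul_eq_mul, star_add]
  rw [@eq_comm _ l k, @eq_comm _ j i]
  split_ifs <;> simp [add_comm]

end Unitary

/-! ### Tensor powers -/

section TensorPower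

universe u

variable {L : Type*} [LieRing L] [LieAlgebra ℂ L] {E : Type u} [AddCommGroup E] [Module ℂ E]
  [LieRingModule L E] [LieModule ℂ L E]

/-- Tensor powers of a unitary module, with the multilinear map that forms pure tensors: it is
equivariant, and pure tensors are separated by products of linear forms. -/
theorem exists_tensorPower {S : Set L} (hE : IsUnitary E S) (n : ℕ) :
    ∃ (T : Type u) (_ : AddCommGroup T) (_ : Module ℂ T) (_ : LieRingModule L T)
      (_ : LieModule ℂ L T) (μ : MultilinearMap ℂ (fun _ : Fin n => E) T), IsUnitary T S ∧
      (∀ (x : L) (v : Fin n → E), ⁅x, μ v⁆ = ∑ i, μ (Function.update v i ⁅x, v i⁆)) ∧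
      ∀ θ : Fin n → Module.Dual ℂ E, ∃ φ : T →ₗ[ℂ] ℂ, ∀ v, φ (μ v) = ∏ i, θ i (v i) := by
  induction n with
  | zero =>
    -- the trivial module
    let i1 : LieRingModule L (ULift.{u} ℂ) :=
      { bracket := fun _ _ => 0
        add_lie := by intros; exact (add_zero _).symm
        lie_add := by intros; exact (add_zero _).symm
        leibniz_lie := by intros; exact (add_zero _).symm }
    let i2 : LieModule ℂ L (ULift.{u} ℂ) :=
      { smul_lie := by intros; exact (smul_zero _).symm
        lie_smul := by intros; exact (smul_zero _).symm }
    refine ⟨ULift.{u} ℂ, inferInstance, inferInstance, i1, i2,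
      MultilinearMap.constOfIsEmpty ℂ _ ⟨1⟩, ?_, ?_, ?_⟩
    · refine ⟨Unit, inferInstance, (Module.Basis.singleton Unit ℂ).map ULift.moduleEquiv.symm, ?_⟩
      intro a _ i j
      have h0 : ∀ t : ULift.{u} ℂ, ⁅a, t⁆ = 0 := fun _ => rfl
      simp [h0]
    · intro x v
      simp only [Finset.univ_eq_empty, Finset.sum_empty]
      rfl
    · exact fun θ => ⟨ULift.moduleEquiv.toLinearMap, fun v => by simp⟩
  | succ n ih =>
    obtain ⟨T, _, _, _, _, μ, hT, hμ, hθ⟩ := ih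
    let g : E →ₗ[ℂ] MultilinearMap ℂ (fun _ : Fin n => E) (E ⊗[ℂ] T) :=
      { toFun := fun x => (TensorProduct.mk ℂ E T x).compMultilinearMap μ
        map_add' := fun x y => by ext; simp
        map_smul' := fun c x => by ext; simp [TensorProduct.smul_tmul'] }
    let G : MultilinearMap ℂ (fun _ : Fin (n + 1) => E) (E ⊗[ℂ] T) :=
      LinearMap.uncurryLeft (M := fun _ => E) g
    have hg : ∀ v : Fin (n + 1) → E, G v = v 0 ⊗ₜ μ (Fin.tail v) := fun v => rfl
    refine ⟨E ⊗[ℂ] T, inferInstance, inferInstance, inferInstance, inferInstance,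
      G, hE.tensorProduct hT, ?_, ?_⟩
    · intro x v
      simp only [hg, TensorProduct.LieModule.lie_tmul_right, hμ, Fin.sum_univ_succ,
        Function.update_self, Fin.tail_update_zero, Fin.tail_update_succ,
        TensorProduct.tmul_sum]
      congr 1
    · intro θ
      obtain ⟨φ, hφ⟩ := hθ (Fin.tail θ)
      refine ⟨LinearMap.mul' ℂ ℂ ∘ₗ TensorProduct.map (θ 0) φ, fun v => ?_⟩
      rw [hg, Fin.prod_univ_succ]
      simp [hφ, Fin.tail]

/-- Exterior powers of a unitary module, realized by antisymmetric tensors. -/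
theorem exists_alternatingPower {S : Set L} (hE : IsUnitary E S) (n : ℕ) :
    ∃ (T : Type u) (_ : AddCommGroup T) (_ : Module ℂ T) (_ : LieRingModule L T)
      (_ : LieModule ℂ L T) (α : E [⋀^Fin n]→ₗ[ℂ] T), IsUnitary T S ∧
      (∀ (x : L) (v : Fin n → E), ⁅x, α v⁆ = ∑ i, α (Function.update v i ⁅x, v i⁆)) ∧
      ∀ (θ : Fin n → Module.Dual ℂ E) (v : Fin n → E),
        (∀ i j, θ i (v j) = if i = j then 1 else 0) → α v ≠ 0 := by
  obtain ⟨T, _, _, _, _, μ, hT, hμ, hθ⟩ := exists_tensorPower hE n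
  refine ⟨T, inferInstance, inferInstance, inferInstance, inferInstance,
    MultilinearMap.alternatization μ, hT, ?_, ?_⟩
  · intro x v
    simp only [MultilinearMap.alternatization_apply, MultilinearMap.domDomCongr_apply, lie_sum]
    rw [Finset.sum_comm]
    refine Finset.sum_congr rfl fun σ _ => ?_
    rw [← Finset.smul_sum, Units.smul_def, Units.smul_def, lie_zsmul, hμ]
    refine congrArg _ (Eq.trans ?_ (Equiv.sum_comp σ _))
    refine Finset.sum_congr rfl fun i _ => ?_
    congr 1
    have := Function.update_comp_equiv v σ (σ i) ⁅x, v (σ i)⁆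
    rw [Equiv.symm_apply_apply] at this
    exact this.symm
  · intro θ v hv h0
    obtain ⟨φ, hφ⟩ := hθ θ
    have h1 := congrArg φ h0
    have h2 : φ (MultilinearMap.alternatization μ v) =
        (Matrix.of fun i j => θ j (v i)).det := by
      rw [MultilinearMap.alternatization_apply, map_sum, Matrix.det_apply]
      refine Finset.sum_congr rfl fun σ _ => ?_
      rw [Units.smul_def, Units.smul_def, map_zsmul, MultilinearMap.domDomCongr_apply, hφ]
      rfl
    have h3 : (Matrix.of fun i j => θ j (v i)) = (1 : Matrix (Fin n) (Fin n) ℂ) := by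
      ext i j
      simp [hv, Matrix.one_apply, @eq_comm _ i j]
    rw [h2, h3, Matrix.det_one, map_zero] at h1
    exact one_ne_zero h1

end TensorPower

/-! ### The Lie algebra of skew-symmetric quaternionic endomorphisms -/

section Real

variable {V : Type*} [NormedAddCommGroup V] [InnerProductSpace ℝ V] (Q : HypercomplexStructure V)

theorem HypercomplexStructure.inner_I_left (x y : V) :
    inner ℝ (Q.I x) y = -inner ℝ x (Q.I y) := by
  rw [← Q.inner_I x (Q.I y), Q.I_sq, inner_neg_right, neg_neg]

theorem HypercomplexStructure.inner_J_left (x y : V) :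
    inner ℝ (Q.J x) y = -inner ℝ x (Q.J y) := by
  rw [← Q.inner_J x (Q.J y), Q.J_sq, inner_neg_right, neg_neg]

theorem HypercomplexStructure.J_I (x : V) : Q.J (Q.I x) = -Q.I (Q.J x) := by
  rw [Q.anticomm, neg_neg]

theorem wedgeEnd_apply (v w x : V) : wedgeEnd v w x = inner ℝ v x • w - inner ℝ w x • v := rfl

theorem coe_add_sp {Q : HypercomplexStructure V} (A B : sp Q) :
    ((A + B : sp Q) : Module.End ℝ V) = A + B := rfl

theorem coe_smul_sp {Q : HypercomplexStructure V} (c : ℝ) (A : sp Q) :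
    ((c • A : sp Q) : Module.End ℝ V) = c • (A : Module.End ℝ V) := rfl

/-- The sum of the conjugates of `v ∧ w` by `1`, `I`, `J`, `K`.  These elements span `𝔰𝔭(p)`. -/
def quatWedge : V →ₗ[ℝ] V →ₗ[ℝ] sp Q :=
  LinearMap.mk₂ ℝ
    (fun v w => ⟨wedgeEnd v w + wedgeEnd (Q.I v) (Q.I w) + wedgeEnd (Q.J v) (Q.J w) +
      wedgeEnd (Q.I (Q.J v)) (Q.I (Q.J w)), by
      refine ⟨fun x y => ?_, fun x => ?_, fun x => ?_⟩
      · simp only [wedgeEnd_apply, LinearMap.add_apply, inner_add_left, inner_add_right,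
          inner_sub_left, inner_sub_right, real_inner_smul_left, real_inner_smul_right]
        simp only [real_inner_comm x]
        ring
      · simp only [wedgeEnd_apply, LinearMap.add_apply, Q.inner_I_left, Q.I_sq, map_add, map_sub,
          map_smul, inner_neg_right]
        module
      · simp only [wedgeEnd_apply, LinearMap.add_apply, Q.inner_I_left, Q.inner_J_left,
          Q.J_sq, Q.J_I, map_add, map_sub, map_smul, map_neg, inner_neg_right]
        module⟩)
    (fun v v' w => by
      ext x
      simp only [coe_add_sp, wedgeEnd_apply, LinearMap.add_apply,
        map_add, inner_add_left]
      module)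
    (fun c v w => by
      ext x
      simp only [coe_smul_sp, wedgeEnd_apply, LinearMap.add_apply,
        LinearMap.smul_apply, map_smul, real_inner_smul_left]
      module)
    (fun v w w' => by
      ext x
      simp only [coe_add_sp, wedgeEnd_apply, LinearMap.add_apply,
        map_add, inner_add_left]
      module)
    (fun c v w => by
      ext x
      simp only [coe_smul_sp, wedgeEnd_apply, LinearMap.add_apply,
        LinearMap.smul_apply, map_smul, real_inner_smul_left]
      module)

variable {Q}

theorem coe_quatWedge (v w : V) : (quatWedge Q v w : Module.End ℝ V) =
    wedgeEnd v w + wedgeEnd (Q.I v) (Q.I w) + wedgeEnd (Q.J v) (Q.J w) +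
      wedgeEnd (Q.I (Q.J v)) (Q.I (Q.J w)) := rfl

theorem sp_inner_left (A : sp Q) (x y : V) : inner ℝ (A.1 x) y = -inner ℝ x (A.1 y) := A.2.1 x y

theorem sp_I (A : sp Q) (x : V) : A.1 (Q.I x) = Q.I (A.1 x) := A.2.2.1 x

theorem sp_J (A : sp Q) (x : V) : A.1 (Q.J x) = Q.J (A.1 x) := A.2.2.2 x

theorem lie_quatWedge (A : sp Q) (v w : V) :
    ⁅A, quatWedge Q v w⁆ = quatWedge Q (A.1 v) w + quatWedge Q v (A.1 w) := by
  ext x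
  simp only [LieSubalgebra.coe_bracket, coe_add_sp, coe_quatWedge, Ring.lie_def,
    LinearMap.sub_apply, LinearMap.add_apply, Module.End.mul_apply, wedgeEnd_apply, map_add,
    map_sub, map_smul, sp_I, sp_J]
  simp only [← sp_I, ← sp_J, sp_inner_left]
  module

theorem torusElement_apply (v x : V) : (torusElement Q v).1 x =
    inner ℝ v x • Q.I v - inner ℝ (Q.I v) x • v -
      (inner ℝ (Q.J v) x • Q.I (Q.J v) - inner ℝ (Q.I (Q.J v)) x • Q.J v) := rfl

theorem quatWedge_I_self (v : V) : quatWedge Q v (Q.I v) = (2 : ℝ) • torusElement Q v := by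
  ext x
  simp only [coe_smul_sp, coe_quatWedge, LinearMap.add_apply, LinearMap.smul_apply,
    wedgeEnd_apply, torusElement_apply, Q.I_sq, Q.J_I, map_neg, inner_neg_left]
  module

section Frame

variable {p : ℕ} {e : Fin p → V}

theorem torusElement_frame (he : IsFrame Q e) (j k : Fin p) :
    (torusElement Q (e j)).1 (e k) = if j = k then Q.I (e k) else 0 := by
  have h0 := orthonormal_iff_ite.1 he (j, 0) (k, 0)
  have h1 := orthonormal_iff_ite.1 he (j, 1) (k, 0)
  have h2 := orthonormal_iff_ite.1 he (j, 2) (k, 0)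
  have h3 := orthonormal_iff_ite.1 he (j, 3) (k, 0)
  simp only [Matrix.cons_val, Prod.mk.injEq, and_true, Fin.reduceEq, and_false, if_false]
    at h0 h1 h2 h3
  rw [torusElement_apply, h0, h1, h2, h3]
  split_ifs with h
  · simp [h]
  · simp

variable [FiniteDimensional ℝ V]

/-- The orthonormal basis of `V` that belongs to a frame. -/
def frameBasis (he : IsFrame Q e) (hdim : Module.finrank ℝ V = 4 * p) :
    OrthonormalBasis (Fin p × Fin 4) ℝ V :=
  (basisOfLinearIndependentOfCardEqFinrank' _ he.linearIndependent
    (by simp [hdim, mul_comm])).toOrthonormalBasis (by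
      rw [coe_basisOfLinearIndependentOfCardEqFinrank']; exact he)

theorem frameBasis_apply (he : IsFrame Q e) (hdim : Module.finrank ℝ V = 4 * p)
    (a : Fin p × Fin 4) : frameBasis he hdim a =
    ![e a.1, Q.I (e a.1), Q.J (e a.1), Q.I (Q.J (e a.1))] a.2 := by
  simp [frameBasis]

theorem sum_frame (he : IsFrame Q e) (hdim : Module.finrank ℝ V = 4 * p)
    (x : V) : x = ∑ k, (inner ℝ (e k) x • e k +
    inner ℝ (Q.I (e k)) x • Q.I (e k) + inner ℝ (Q.J (e k)) x • Q.J (e k) +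
      inner ℝ (Q.I (Q.J (e k))) x • Q.I (Q.J (e k))) := by
  conv_lhs => rw [← (frameBasis he hdim).sum_repr' x]
  simp [Fintype.sum_prod_type, Fin.sum_univ_four, frameBasis_apply]

/-- An element of `𝔰𝔭(p)` is a sum of elements `quatWedge`. -/
theorem two_smul_eq_sum_quatWedge (he : IsFrame Q e) (hdim : Module.finrank ℝ V = 4 * p)
    (A : sp Q) :
    (2 : ℝ) • A = ∑ k, quatWedge Q (e k) (A.1 (e k)) := by
  ext x
  have h1 := congrArg A.1 (sum_frame he hdim x)
  have h2 := sum_frame he hdim (A.1 x)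
  have h3 : (∑ k, quatWedge Q (e k) (A.1 (e k))).1 x =
      ∑ k, (quatWedge Q (e k) (A.1 (e k))).1 x :=
    map_sum (LinearMap.applyₗ x ∘ₗ (sp Q).toSubmodule.subtype) _ _
  rw [map_sum] at h1
  change (2 : ℝ) • A.1 x = _
  rw [h3, two_smul]
  conv_lhs => enter [2]; rw [h2]
  conv_lhs => enter [1]; rw [h1]
  rw [← Finset.sum_add_distrib]
  refine Finset.sum_congr rfl fun k _ => ?_
  simp only [coe_quatWedge, LinearMap.add_apply, wedgeEnd_apply, map_add, map_smul, sp_I, sp_J]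
  simp only [← sp_I, ← sp_J, sp_inner_left]
  module

/-- The torus elements span their own centralizer. -/
theorem mem_span_torusElement (he : IsFrame Q e) (hdim : Module.finrank ℝ V = 4 * p)
    (B : sp Q) (hB : ∀ k, ⁅torusElement Q (e k), B⁆ = 0) :
    B ∈ Submodule.span ℝ (Set.range fun k => torusElement Q (e k)) := by
  have hcomm : ∀ k x, (torusElement Q (e k)).1 (B.1 x) = B.1 ((torusElement Q (e k)).1 x) := by
    intro k x
    have := congrArg (fun A : sp Q => A.1 x) (hB k)
    exact sub_eq_zero.1 this
  -- `H_k` acts on `B e_k` as `I`, which leaves only the component along `I e_k`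
  have key : ∀ k, B.1 (e k) = inner ℝ (Q.I (e k)) (B.1 (e k)) • Q.I (e k) := by
    intro k
    have h1 : Q.I (B.1 (e k)) = (torusElement Q (e k)).1 (B.1 (e k)) := by
      rw [hcomm, torusElement_frame he, if_pos rfl, sp_I]
    rw [torusElement_apply] at h1
    replace h1 := congrArg Q.I h1
    simp only [Q.I_sq, map_sub, map_smul] at h1
    have o : ∀ m n : Fin 4, _ := fun m n => orthonormal_iff_ite.1 he (k, m) (k, n)
    have h0 : inner ℝ (e k) (B.1 (e k)) = 0 := by
      have := sp_inner_left B (e k) (e k)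
      rw [real_inner_comm] at this
      linarith
    have hJ := congrArg (inner ℝ (Q.J (e k))) h1
    have hK := congrArg (inner ℝ (Q.I (Q.J (e k)))) h1
    have o20 := o 2 0
    have o21 := o 2 1
    have o22 := o 2 2
    have o23 := o 2 3
    have o30 := o 3 0
    have o31 := o 3 1
    have o32 := o 3 2
    have o33 := o 3 3
    simp only [Matrix.cons_val, Prod.mk.injEq, true_and, Fin.reduceEq, if_false, if_true]
      at o20 o21 o22 o23 o30 o31 o32 o33
    simp only [inner_neg_right, inner_sub_right, real_inner_smul_right, o20, o21, o22, o23, o30,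
      o31, o32, o33] at hJ hK
    have hJ0 : inner ℝ (Q.J (e k)) (B.1 (e k)) = 0 := by linarith
    have hK0 : inner ℝ (Q.I (Q.J (e k))) (B.1 (e k)) = 0 := by linarith
    rw [h0, hJ0, hK0] at h1
    rw [← neg_inj, h1]
    module
  have h2 := two_smul_eq_sum_quatWedge he hdim B
  have h3 : B = (2⁻¹ : ℝ) • (2 : ℝ) • B := by rw [smul_smul]; norm_num
  rw [h3, h2]
  refine Submodule.smul_mem _ _ (sum_mem fun k _ => ?_)
  rw [key, map_smul, quatWedge_I_self]
  exact Submodule.smul_mem _ _ (Submodule.smul_mem _ _ (Submodule.subset_span ⟨k, rfl⟩))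

end Frame

end Real

/-! ### Weights of the complexified Lie algebra -/

section Complex

variable {V : Type*} [NormedAddCommGroup V] [InnerProductSpace ℝ V] {Q : HypercomplexStructure V}

theorem lie_tmul_Vc (c d : ℂ) (A : sp Q) (x : V) :
    ⁅(c ⊗ₜ[ℝ] A : SpC Q), (d ⊗ₜ[ℝ] x : Vc V)⁆ = (c * d) ⊗ₜ[ℝ] A.1 x := rfl

-- `lie_zero` and `lie_add` for the modules at hand, where rewriting with the general lemmas does
-- not unify the additive structures of the tensor products.
theorem lie_zero_Vc (x : SpC Q) : ⁅x, (0 : Vc V)⁆ = 0 := lie_zero x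

theorem lie_add_Vc (x : SpC Q) (u v : Vc V) : ⁅x, u + v⁆ = ⁅x, u⁆ + ⁅x, v⁆ := lie_add x u v

theorem lie_zero_SpC (x : SpC Q) : ⁅x, (0 : SpC Q)⁆ = 0 := lie_zero x

theorem lie_add_SpC (x y z : SpC Q) : ⁅x, y + z⁆ = ⁅x, y⁆ + ⁅x, z⁆ := lie_add x y z

variable (Q) in
/-- The complex bilinear extension of `quatWedge`. -/
def complexQuatWedge : Vc V →ₗ[ℂ] Vc V →ₗ[ℂ] SpC Q :=
  LinearMap.BilinMap.baseChange ℂ (quatWedge Q)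

theorem complexQuatWedge_tmul (c d : ℂ) (x y : V) :
    complexQuatWedge Q (c ⊗ₜ x) (d ⊗ₜ y) = (c * d) ⊗ₜ quatWedge Q x y := rfl

theorem lie_complexQuatWedge (A : sp Q) (u v : Vc V) :
    ⁅((1 : ℂ) ⊗ₜ[ℝ] A : SpC Q), complexQuatWedge Q u v⁆ =
      complexQuatWedge Q ⁅((1 : ℂ) ⊗ₜ[ℝ] A : SpC Q), u⁆ v +
        complexQuatWedge Q u ⁅((1 : ℂ) ⊗ₜ[ℝ] A : SpC Q), v⁆ := by
  induction u using TensorProduct.induction_on with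
  | zero => rw [lie_zero_Vc, map_zero, LinearMap.zero_apply, lie_zero_SpC,
      LinearMap.zero_apply, add_zero]
  | add x y hx hy =>
    rw [lie_add_Vc, map_add, map_add, LinearMap.add_apply, LinearMap.add_apply,
      LinearMap.add_apply, lie_add_SpC, hx, hy]
    abel
  | tmul c x =>
    induction v using TensorProduct.induction_on with
    | zero => rw [lie_zero_Vc, map_zero, map_zero, lie_zero_SpC, add_zero]
    | add x y hx hy =>
      rw [lie_add_Vc, map_add, map_add, map_add, lie_add_SpC, hx, hy]
      abel
    | tmul d y =>
      rw [lie_tmul_Vc, lie_tmul_Vc, complexQuatWedge_tmul, complexQuatWedge_tmul,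
        complexQuatWedge_tmul, LieAlgebra.ExtendScalars.bracket_tmul, lie_quatWedge,
        TensorProduct.tmul_add, one_mul, one_mul, one_mul]

variable {p : ℕ} {e : Fin p → V}

theorem HasWeight.complexQuatWedge {a b : Fin p → ℤ} {u v : Vc V} (hu : HasWeight Q e a u)
    (hv : HasWeight Q e b v) : HasWeight Q e (a + b) (complexQuatWedge Q u v) := by
  intro k
  rw [lie_complexQuatWedge, hu k, hv k]
  simp only [map_smul, LinearMap.smul_apply, Pi.add_apply, Int.cast_add]
  module

theorem HasWeight.lie {M : Type*} [AddCommGroup M] [Module ℂ M] [LieRingModule (SpC Q) M]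
    [LieModule ℂ (SpC Q) M] {a b : Fin p → ℤ} {x : SpC Q} {m : M} (hx : HasWeight Q e a x)
    (hm : HasWeight Q e b m) : HasWeight Q e (a + b) ⁅x, m⁆ := by
  intro k
  rw [leibniz_lie, hx k, hm k, smul_lie, lie_smul, ← add_smul, Pi.add_apply]
  push_cast
  ring_nf

variable (Q e) in
/-- The weight vectors of `V_c` that belong to a frame. -/
def weightVector (a : Fin p × Fin 4) : Vc V :=
  ![1 ⊗ₜ e a.1 - Complex.I ⊗ₜ Q.I (e a.1), 1 ⊗ₜ e a.1 + Complex.I ⊗ₜ Q.I (e a.1),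
    1 ⊗ₜ Q.J (e a.1) + Complex.I ⊗ₜ Q.I (Q.J (e a.1)),
    1 ⊗ₜ Q.J (e a.1) - Complex.I ⊗ₜ Q.I (Q.J (e a.1))] a.2

/-- The weight of `weightVector Q e a`. -/
def weight (a : Fin p × Fin 4) : Fin p → ℤ := Pi.single a.1 (![1, -1, 1, -1] a.2)

theorem hasWeight_weightVector (he : IsFrame Q e) (a : Fin p × Fin 4) :
    HasWeight Q e (weight a) (weightVector Q e a) := by
  obtain ⟨k, n⟩ := a
  intro j
  have h0 := torusElement_frame he j k
  by_cases hjk : j = k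
  · subst hjk
    rw [if_pos rfl] at h0
    fin_cases n <;>
    simp [weightVector, weight, sp_I, sp_J, h0, Q.J_I, Q.I_sq, TensorProduct.tmul_neg,
      TensorProduct.smul_tmul', smul_add, add_comm, sub_eq_add_neg,
      TensorProduct.neg_tmul]
  · rw [if_neg hjk] at h0
    fin_cases n <;>
    simp [weightVector, weight, sp_I, sp_J, h0, hjk]

variable (Q) in
/-- The complex linear extension of `I`. -/
def complexI : Vc V →ₗ[ℂ] Vc V := Q.I.baseChange ℂ

theorem complexI_lie (x : SpC Q) (v : Vc V) : complexI Q ⁅x, v⁆ = ⁅x, complexI Q v⁆ := by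
  induction x using TensorProduct.induction_on with
  | zero => simp
  | add x y hx hy => simp only [add_lie, map_add, hx, hy]
  | tmul c A =>
    induction v using TensorProduct.induction_on with
    | zero => rw [lie_zero_Vc, map_zero, lie_zero_Vc]
    | add x y hx hy => rw [lie_add_Vc, map_add, map_add, lie_add_Vc, hx, hy]
    | tmul d x =>
      simp only [complexI, lie_tmul_Vc, LinearMap.baseChange_tmul, sp_I]

theorem complexI_weightVector (a : Fin p × Fin 4) : complexI Q (weightVector Q e a) =
    (Complex.I * ![1, -1, -1, 1] a.2) • weightVector Q e a := by
  obtain ⟨k, n⟩ := a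
  fin_cases n <;>
  simp [weightVector, complexI, Q.I_sq, TensorProduct.tmul_neg,
      TensorProduct.smul_tmul', smul_add, add_comm, sub_eq_add_neg,
      TensorProduct.neg_tmul]

variable [FiniteDimensional ℝ V]

theorem span_weightVector (he : IsFrame Q e) (hdim : Module.finrank ℝ V = 4 * p) :
    Submodule.span ℂ (Set.range (weightVector Q e)) = ⊤ := by
  set S := Submodule.span ℂ (Set.range (weightVector Q e)) with hS
  have hw : ∀ a, weightVector Q e a ∈ S := fun a => Submodule.subset_span ⟨a, rfl⟩
  have hb : ∀ a, (1 : ℂ) ⊗ₜ[ℝ] frameBasis he hdim a ∈ S := by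
    rintro ⟨k, n⟩
    have h0 := hw (k, 0)
    have h1 := hw (k, 1)
    have h2 := hw (k, 2)
    have h3 := hw (k, 3)
    simp only [weightVector, Matrix.cons_val] at h0 h1 h2 h3
    have hI : ∀ x : V, (1 : ℂ) ⊗ₜ[ℝ] x = -Complex.I • (Complex.I ⊗ₜ[ℝ] x) := fun x => by
      rw [TensorProduct.smul_tmul', smul_eq_mul, neg_mul, Complex.I_mul_I, neg_neg]
    rw [frameBasis_apply]
    fin_cases n
    · have := S.smul_mem (2⁻¹ : ℂ) (add_mem h0 h1)
      convert this using 1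
      simp
      module
    · have := S.smul_mem (-Complex.I * 2⁻¹ : ℂ) (sub_mem h1 h0)
      convert this using 1
      simp only [Fin.mk_one, Matrix.cons_val]
      rw [hI]
      module
    · have := S.smul_mem (2⁻¹ : ℂ) (add_mem h2 h3)
      convert this using 1
      simp
      module
    · have := S.smul_mem (-Complex.I * 2⁻¹ : ℂ) (sub_mem h2 h3)
      convert this using 1
      simp only [Fin.reduceFinMk, Matrix.cons_val]
      rw [hI]
      module
  rw [eq_top_iff, ← ((frameBasis he hdim).toBasis.baseChange ℂ).span_eq, Submodule.span_le]
  rintro _ ⟨a, rfl⟩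
  rw [Module.Basis.baseChange_apply]
  simpa using hb a

/-- The basis of `V_c` that consists of the weight vectors. -/
def weightBasis (he : IsFrame Q e) (hdim : Module.finrank ℝ V = 4 * p) :
    Module.Basis (Fin p × Fin 4) ℂ (Vc V) :=
  basisOfTopLeSpanOfCardEqFinrank (weightVector Q e) (span_weightVector he hdim).ge
    (by simp [hdim, mul_comm])

theorem weightBasis_apply (he : IsFrame Q e) (hdim : Module.finrank ℝ V = 4 * p)
    (a : Fin p × Fin 4) : weightBasis he hdim a = weightVector Q e a := by
  simp [weightBasis]

/-- In a basis of eigenvectors, an eigenvector is a combination of basis vectors with its own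
eigenvalue. -/
theorem eigenvalue_eq_of_repr_ne_zero {ι M : Type*} [AddCommGroup M] [Module ℂ M]
    (b : Module.Basis ι ℂ M) (f : M →ₗ[ℂ] M) {c : ι → ℂ} (hf : ∀ i, f (b i) = c i • b i) {d : ℂ}
    {m : M} (hm : f m = d • m) {i : ι} (hi : b.repr m i ≠ 0) : c i = d := by
  have h : b.coord i ∘ₗ f = c i • b.coord i := by
    refine b.ext fun j => ?_
    simp only [LinearMap.comp_apply, hf, map_smul, LinearMap.smul_apply, Module.Basis.coord_apply,
      Module.Basis.repr_self, smul_eq_mul]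
    by_cases hij : j = i
    · rw [hij]
    · rw [Finsupp.single_eq_of_ne (Ne.symm hij), mul_zero, mul_zero]
  have h1 := LinearMap.congr_fun h m
  simp only [LinearMap.comp_apply, hm, map_smul, LinearMap.smul_apply, Module.Basis.coord_apply,
    smul_eq_mul] at h1
  exact (mul_right_cancel₀ hi h1).symm

theorem weight_eq_of_repr_ne_zero (he : IsFrame Q e) (hdim : Module.finrank ℝ V = 4 * p)
    {l : Fin p → ℤ} {v : Vc V} (hv : HasWeight Q e l v) {a : Fin p × Fin 4}
    (ha : (weightBasis he hdim).repr v a ≠ 0) : weight a = l := by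
  funext k
  have := eigenvalue_eq_of_repr_ne_zero (weightBasis he hdim)
    (LieModule.toEnd ℂ (SpC Q) (Vc V) (1 ⊗ₜ torusElement Q (e k)))
    (c := fun a => Complex.I * (weight a k : ℂ))
    (fun a => by rw [weightBasis_apply]; exact hasWeight_weightVector he a k) (hv k) ha
  exact_mod_cast mul_left_cancel₀ Complex.I_ne_zero this

/-- The complexified Lie algebra is spanned by elements whose weights are sums of two weights
of `V_c`. -/
theorem span_complexQuatWedge (he : IsFrame Q e) (hdim : Module.finrank ℝ V = 4 * p) :
    Submodule.span ℂ (Set.range fun c : (Fin p × Fin 4) × (Fin p × Fin 4) =>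
      complexQuatWedge Q (weightVector Q e c.1) (weightVector Q e c.2)) = ⊤ := by
  set S := Submodule.span ℂ (Set.range fun c : (Fin p × Fin 4) × (Fin p × Fin 4) =>
      complexQuatWedge Q (weightVector Q e c.1) (weightVector Q e c.2))
  have h1 : ∀ u v, complexQuatWedge Q u v ∈ S := by
    intro u v
    have hu : u ∈ Submodule.span ℂ (Set.range (weightVector Q e)) :=
      span_weightVector he hdim ▸ Submodule.mem_top
    have hv : v ∈ Submodule.span ℂ (Set.range (weightVector Q e)) :=
      span_weightVector he hdim ▸ Submodule.mem_top
    induction hu, hv using Submodule.span_induction₂ with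
    | mem_mem x y hx hy =>
      obtain ⟨a, rfl⟩ := hx
      obtain ⟨b, rfl⟩ := hy
      exact Submodule.subset_span ⟨(a, b), rfl⟩
    | zero_left => simp
    | zero_right => simp
    | add_left _ _ _ _ _ _ h1 h2 => rw [map_add]; exact add_mem h1 h2
    | add_right _ _ _ _ _ _ h1 h2 => rw [map_add]; exact add_mem h1 h2
    | smul_left c _ _ _ _ h => rw [map_smul]; exact Submodule.smul_mem _ _ h
    | smul_right c _ _ _ _ h => rw [map_smul]; exact Submodule.smul_mem _ _ h
  rw [eq_top_iff]
  rintro x -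
  induction x using TensorProduct.induction_on with
  | zero => exact zero_mem _
  | add x y hx hy => exact add_mem hx hy
  | tmul c A =>
    have h2 : c ⊗ₜ[ℝ] A = (c * 2⁻¹) • ∑ k, complexQuatWedge Q (1 ⊗ₜ e k) (1 ⊗ₜ A.1 (e k)) := by
      simp only [complexQuatWedge_tmul, ← TensorProduct.tmul_sum,
        ← two_smul_eq_sum_quatWedge he hdim A]
      rw [← TensorProduct.smul_tmul, TensorProduct.smul_tmul']
      congr 1
      simp
    rw [h2]
    exact Submodule.smul_mem _ _ (sum_mem fun k _ => h1 _ _)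

/-- Elements of weight zero are combinations of torus elements. -/
theorem mem_span_torusElement_of_hasWeight_zero (he : IsFrame Q e)
    (hdim : Module.finrank ℝ V = 4 * p) {x : SpC Q} (hx : HasWeight Q e 0 x) :
    x ∈ Submodule.span ℂ (Set.range fun k => ((1 : ℂ) ⊗ₜ[ℝ] torusElement Q (e k) : SpC Q)) := by
  -- the decomposition of `x` into its real and its imaginary part
  obtain ⟨B, C, rfl⟩ : ∃ B C : sp Q, x = (1 : ℂ) ⊗ₜ B + Complex.I ⊗ₜ C := by
    clear hx
    induction x using TensorProduct.induction_on with
    | zero => exact ⟨0, 0, by simp⟩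
    | add x y hx hy =>
      obtain ⟨B, C, rfl⟩ := hx
      obtain ⟨B', C', rfl⟩ := hy
      exact ⟨B + B', C + C', by simp only [TensorProduct.tmul_add]; abel⟩
    | tmul c A =>
      refine ⟨c.re • A, c.im • A, ?_⟩
      rw [← TensorProduct.smul_tmul, ← TensorProduct.smul_tmul, ← TensorProduct.add_tmul]
      congr 1
      simp [Complex.re_add_im]
  let part (f : ℂ →ₗ[ℝ] ℝ) : SpC Q →ₗ[ℝ] sp Q :=
    (TensorProduct.lid ℝ (sp Q)).toLinearMap ∘ₗ TensorProduct.map f LinearMap.id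
  have h0 : ∀ k, ⁅torusElement Q (e k), B⁆ = 0 ∧ ⁅torusElement Q (e k), C⁆ = 0 := by
    intro k
    have h := hx k
    rw [lie_add, LieAlgebra.ExtendScalars.bracket_tmul, LieAlgebra.ExtendScalars.bracket_tmul,
      Pi.zero_apply, Int.cast_zero, mul_zero, zero_smul, one_mul, one_mul] at h
    constructor
    · simpa [part] using congrArg (part Complex.reLm) h
    · simpa [part] using congrArg (part Complex.imLm) h
  have h1 : ∀ (c : ℂ), ∀ A ∈ Submodule.span ℝ (Set.range fun k => torusElement Q (e k)),
      c ⊗ₜ[ℝ] A ∈ Submodule.span ℂ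
        (Set.range fun k => ((1 : ℂ) ⊗ₜ[ℝ] torusElement Q (e k) : SpC Q)) := by
    intro c A hA
    induction hA using Submodule.span_induction with
    | mem A hA =>
      obtain ⟨k, rfl⟩ := hA
      have : c ⊗ₜ[ℝ] torusElement Q (e k) = c • ((1 : ℂ) ⊗ₜ[ℝ] torusElement Q (e k) : SpC Q) := by
        rw [TensorProduct.smul_tmul', smul_eq_mul, mul_one]
      rw [this]
      exact Submodule.smul_mem _ _ (Submodule.subset_span ⟨k, rfl⟩)
    | zero => rw [TensorProduct.tmul_zero]; exact zero_mem _
    | add A B _ _ h1 h2 => rw [TensorProduct.tmul_add]; exact add_mem h1 h2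
    | smul r A _ h =>
      rw [TensorProduct.tmul_smul, ← algebraMap_smul ℂ r]
      exact Submodule.smul_mem _ _ h
  exact add_mem (h1 _ _ (mem_span_torusElement he hdim B fun k => (h0 k).1))
    (h1 _ _ (mem_span_torusElement he hdim C fun k => (h0 k).2))

end Complex

/-! ### Positive roots and highest weight vectors -/

section Roots

variable {p : ℕ}

/-- A linear form on weights that is positive on the positive roots. -/
def height : (Fin p → ℤ) →+ ℤ where
  toFun a := ∑ k : Fin p, ((p : ℤ) - (k : ℕ)) * a k
  map_zero' := by simp
  map_add' a b := by simp [mul_add, Finset.sum_add_distrib]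

theorem height_apply (a : Fin p → ℤ) : height a = ∑ k : Fin p, ((p : ℤ) - (k : ℕ)) * a k := rfl

theorem height_single (k : Fin p) (c : ℤ) : height (Pi.single k c) = ((p : ℤ) - (k : ℕ)) * c := by
  rw [height_apply, Finset.sum_eq_single k]
  · simp
  · intro l _ hl
    simp [hl]
  · simp

theorem height_pos {a : Fin p → ℤ} (ha : IsPositiveRoot a) : 0 < height a := by
  rcases ha with ⟨k, l, hkl, rfl | rfl⟩ | ⟨k, rfl⟩
  · rw [map_sub, height_single, height_single]
    have : (k : ℕ) < l := hkl
    omega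
  · rw [map_add, height_single, height_single]
    omega
  · rw [height_single]
    omega

/-- The sum of two weights of `V_c` is zero or a root. -/
theorem weight_add_weight (a b : Fin p × Fin 4) : weight a + weight b = 0 ∨
    IsPositiveRoot (weight a + weight b) ∨ IsPositiveRoot (-(weight a + weight b)) := by
  have sign : ∀ n : Fin 4, (![1, -1, 1, -1] n : ℤ) = 1 ∨ (![1, -1, 1, -1] n : ℤ) = -1 := by
    decide
  obtain ⟨k, m⟩ := a
  obtain ⟨l, n⟩ := b
  simp only [weight]
  rcases lt_trichotomy k l with hkl | rfl | hkl
  · rcases sign m with h | h <;> rcases sign n with h' | h' <;> rw [h, h']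
    · exact .inr (.inl (.inl ⟨k, l, hkl, .inr rfl⟩))
    · refine .inr (.inl (.inl ⟨k, l, hkl, .inl ?_⟩))
      rw [Pi.single_neg, sub_eq_add_neg]
    · refine .inr (.inr (.inl ⟨k, l, hkl, .inl ?_⟩))
      rw [Pi.single_neg]
      abel
    · refine .inr (.inr (.inl ⟨k, l, hkl, .inr ?_⟩))
      rw [Pi.single_neg, Pi.single_neg]
      abel
  · rw [← Pi.single_add]
    rcases sign m with h | h <;> rcases sign n with h' | h' <;> rw [h, h']
    · exact .inr (.inl (.inr ⟨k, rfl⟩))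
    · exact .inl (by simp)
    · exact .inl (by simp)
    · exact .inr (.inr (.inr ⟨k, by rw [← Pi.single_neg]; rfl⟩))
  · rcases sign m with h | h <;> rcases sign n with h' | h' <;> rw [h, h']
    · exact .inr (.inl (.inl ⟨l, k, hkl, .inr (add_comm _ _)⟩))
    · refine .inr (.inr (.inl ⟨l, k, hkl, .inl ?_⟩))
      rw [Pi.single_neg]
      abel
    · refine .inr (.inl (.inl ⟨l, k, hkl, .inl ?_⟩))
      rw [Pi.single_neg]
      abel
    · refine .inr (.inr (.inl ⟨l, k, hkl, .inr ?_⟩))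
      rw [Pi.single_neg, Pi.single_neg]
      abel

end Roots

section HighestWeightVectors

variable {V : Type*} [NormedAddCommGroup V] [InnerProductSpace ℝ V] {Q : HypercomplexStructure V}
  {p : ℕ} {e : Fin p → V}

variable (Q e) in
/-- The element of the Cartan subalgebra on which weights take the value `height`. -/
def gradingElement : SpC Q :=
  ∑ k : Fin p, (-Complex.I * ((p : ℂ) - (k : ℕ))) • ((1 : ℂ) ⊗ₜ[ℝ] torusElement Q (e k))

theorem HasWeight.gradingElement_lie {M : Type*} [AddCommGroup M] [Module ℂ M]
    [LieRingModule (SpC Q) M] [LieModule ℂ (SpC Q) M] {a : Fin p → ℤ} {m : M}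
    (hm : HasWeight Q e a m) : ⁅gradingElement Q e, m⁆ = ((height a : ℤ) : ℂ) • m := by
  rw [gradingElement, sum_lie, height_apply, Int.cast_sum, Finset.sum_smul]
  refine Finset.sum_congr rfl fun k _ => ?_
  refine (smul_lie (_ : ℂ) (_ : SpC Q) m).trans ?_
  rw [hm k, smul_smul]
  congr 1
  push_cast
  linear_combination (-((p : ℂ) - (k : ℕ)) * (a k : ℂ)) * Complex.I_mul_I

variable (Q e) in
/-- `m` has weight `l` and is killed by the positive root vectors. -/
def IsHighestWeightVector {M : Type*} [AddCommGroup M] [Module ℂ M] [LieRingModule (SpC Q) M]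
    (l : Fin p → ℤ) (m : M) : Prop :=
  HasWeight Q e l m ∧
    ∀ (a : Fin p → ℤ) (x : SpC Q), IsPositiveRoot a → HasWeight Q e a x → ⁅x, m⁆ = 0

variable (Q e) in
/-- The Borel subalgebra that belongs to the positive roots, as the span of the elements of weight
zero and of the positive root vectors. -/
def borel : Submodule ℂ (SpC Q) :=
  Submodule.span ℂ {x | HasWeight Q e 0 x ∨ ∃ a, IsPositiveRoot a ∧ HasWeight Q e a x}

variable (Q e) in
/-- The negative root vectors. -/
def negativeRootVectors : Set (SpC Q) := {x | ∃ a, IsPositiveRoot (-a) ∧ HasWeight Q e a x}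

variable [FiniteDimensional ℝ V]

theorem borel_sup_span_negativeRootVectors (he : IsFrame Q e)
    (hdim : Module.finrank ℝ V = 4 * p) :
    borel Q e ⊔ Submodule.span ℂ (negativeRootVectors Q e) = ⊤ := by
  rw [eq_top_iff, ← span_complexQuatWedge he hdim, Submodule.span_le]
  rintro _ ⟨⟨a, b⟩, rfl⟩
  have h := (hasWeight_weightVector he a).complexQuatWedge (hasWeight_weightVector he b)
  rcases weight_add_weight a b with h0 | h1 | h1
  · exact Submodule.mem_sup_left (Submodule.subset_span (.inl (h0 ▸ h)))
  · exact Submodule.mem_sup_left (Submodule.subset_span (.inr ⟨_, h1, h⟩))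
  · exact Submodule.mem_sup_right (Submodule.subset_span ⟨_, h1, h⟩)

theorem IsHighestWeightVector.lie_mem_span (he : IsFrame Q e)
    (hdim : Module.finrank ℝ V = 4 * p) {M : Type*} [AddCommGroup M] [Module ℂ M]
    [LieRingModule (SpC Q) M] [LieModule ℂ (SpC Q) M] {l : Fin p → ℤ} {m : M}
    (hm : IsHighestWeightVector Q e l m) {x : SpC Q} (hx : x ∈ borel Q e) :
    ⁅x, m⁆ ∈ Submodule.span ℂ {m} := by
  induction hx using Submodule.span_induction with
  | zero => rw [zero_lie]; exact zero_mem _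
  | add x y _ _ h1 h2 => rw [add_lie]; exact add_mem h1 h2
  | smul c x _ h => rw [smul_lie]; exact Submodule.smul_mem _ _ h
  | mem x hx =>
    rcases hx with h0 | ⟨a, ha, hx⟩
    · have hx := mem_span_torusElement_of_hasWeight_zero he hdim h0
      clear h0
      induction hx using Submodule.span_induction with
      | zero => rw [zero_lie]; exact zero_mem _
      | add x y _ _ h1 h2 => rw [add_lie]; exact add_mem h1 h2
      | smul c x _ h => rw [smul_lie]; exact Submodule.smul_mem _ _ h
      | mem x hx =>
        obtain ⟨k, rfl⟩ := hx
        change ⁅((1 : ℂ) ⊗ₜ[ℝ] torusElement Q (e k) : SpC Q), m⁆ ∈ _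
        rw [hm.1 k]
        exact Submodule.smul_mem _ _ (Submodule.mem_span_singleton_self m)
    · rw [hm.2 a x ha hx]
      exact zero_mem _

/-- In the module generated by a highest weight vector, the vectors of the highest weight are
multiples of this vector. -/
theorem IsHighestWeightVector.mem_span_of_hasWeight (he : IsFrame Q e)
    (hdim : Module.finrank ℝ V = 4 * p) {M : Type*} [AddCommGroup M] [Module ℂ M]
    [LieRingModule (SpC Q) M] [LieModule ℂ (SpC Q) M] {l : Fin p → ℤ} {m : M}
    (hm : IsHighestWeightVector Q e l m) {y : M}
    (hy : y ∈ LieSubmodule.lieSpan ℂ (SpC Q) {m}) (hyl : HasWeight Q e l y) :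
    y ∈ Submodule.span ℂ {m} := by
  refine mem_span_singleton_of_mem_lieSpan (borel_sup_span_negativeRootVectors he hdim)
    (fun b hb => hm.lie_mem_span he hdim hb) (h := gradingElement Q e) ?_
    hm.1.gradingElement_lie hy hyl.gradingElement_lie
  rintro f ⟨a, ha, hf⟩
  have := height_pos ha
  rw [map_neg] at this
  exact ⟨height a, by omega, hf.gradingElement_lie⟩

end HighestWeightVectors

/-! ### The fundamental modules in the exterior powers of `V_c` -/

section Exterior

universe u

variable {V : Type u} [NormedAddCommGroup V] [InnerProductSpace ℝ V]
  {Q : HypercomplexStructure V} {p : ℕ} {e : Fin p → V}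

variable (Q) in
/-- The real form `𝔰𝔭(p)` of its complexification. -/
def realElements : Set (SpC Q) := Set.range fun A : sp Q => (1 : ℂ) ⊗ₜ[ℝ] A

theorem span_realElements : Submodule.span ℂ (realElements Q) = ⊤ := by
  rw [eq_top_iff]
  rintro x -
  induction x using TensorProduct.induction_on with
  | zero => exact zero_mem _
  | add x y hx hy => exact add_mem hx hy
  | tmul c A =>
    have : c ⊗ₜ[ℝ] A = c • ((1 : ℂ) ⊗ₜ[ℝ] A : SpC Q) := by
      rw [TensorProduct.smul_tmul', smul_eq_mul, mul_one]
    rw [this]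
    exact Submodule.smul_mem _ _ (Submodule.subset_span ⟨A, rfl⟩)

variable [FiniteDimensional ℝ V]

theorem isUnitary_Vc : IsUnitary (Vc V) (realElements Q) := by
  refine ⟨_, inferInstance, (stdOrthonormalBasis ℝ V).toBasis.baseChange ℂ, ?_⟩
  rintro _ ⟨A, rfl⟩ i j
  have h : ∀ i j, inner ℝ (stdOrthonormalBasis ℝ V i) (A.1 (stdOrthonormalBasis ℝ V j)) =
      -inner ℝ (stdOrthonormalBasis ℝ V j) (A.1 (stdOrthonormalBasis ℝ V i)) := fun i j => by
    rw [← sp_inner_left, real_inner_comm]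
  simp only [Module.Basis.baseChange_apply, lie_tmul_Vc, Module.Basis.baseChange_repr_tmul,
    OrthonormalBasis.coe_toBasis, OrthonormalBasis.coe_toBasis_repr_apply,
    OrthonormalBasis.repr_apply_apply]
  rw [h i j]
  simp

/-- A positive root vector maps a weight vector `v_k` of weight `ε_k` in the `I`-eigenspace to a
combination of the `v_l` with `l < k`. -/
theorem lie_weightVector_mem_span (he : IsFrame Q e) (hdim : Module.finrank ℝ V = 4 * p)
    {a : Fin p → ℤ} (ha : IsPositiveRoot a) {x : SpC Q} (hx : HasWeight Q e a x) (k : Fin p) :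
    ⁅x, weightVector Q e (k, 0)⁆ ∈
      Submodule.span ℂ ((fun l => weightVector Q e (l, 0)) '' Set.Iio k) := by
  have hw := hx.lie (hasWeight_weightVector he (k, 0))
  have hI : complexI Q ⁅x, weightVector Q e (k, 0)⁆ =
      Complex.I • ⁅x, weightVector Q e (k, 0)⁆ := by
    rw [complexI_lie, complexI_weightVector, Matrix.cons_val_zero, mul_one]
    exact lie_smul Complex.I x (weightVector Q e (k, 0))
  rw [← (weightBasis he hdim).sum_repr ⁅x, weightVector Q e (k, 0)⁆]
  refine sum_mem fun b _ => ?_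
  by_cases hb : (weightBasis he hdim).repr ⁅x, weightVector Q e (k, 0)⁆ b = 0
  · rw [hb, zero_smul]
    exact zero_mem _
  refine Submodule.smul_mem _ _ ?_
  have h1 := congrArg height (weight_eq_of_repr_ne_zero he hdim hw hb)
  have h2 := eigenvalue_eq_of_repr_ne_zero (weightBasis he hdim) (complexI Q)
    (fun a => by rw [weightBasis_apply]; exact complexI_weightVector a) hI hb
  have h3 := height_pos ha
  obtain ⟨l, n⟩ := b
  rw [weightBasis_apply]
  rw [map_add, weight, weight, height_single, height_single] at h1
  have hk := k.2
  have hl := l.2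
  fin_cases n
  · refine Submodule.subset_span ⟨l, ?_, rfl⟩
    change (l : ℕ) < k
    simp at h1
    omega
  · simp at h1
    omega
  · simp at h2
    exact absurd (neg_eq_self.1 h2) Complex.I_ne_zero
  · simp at h1
    omega

/-- The vector `v_0 ∧ … ∧ v_{s-1}` of weight `(1, …, 1, 0, …, 0)`. -/
theorem exists_unitary_highestWeightVector (he : IsFrame Q e)
    (hdim : Module.finrank ℝ V = 4 * p) {s : ℕ} (hs : s ≤ p) :
    ∃ (T : Type u) (_ : AddCommGroup T) (_ : Module ℂ T) (_ : LieRingModule (SpC Q) T)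
      (_ : LieModule ℂ (SpC Q) T) (m : T), IsUnitary T (realElements Q) ∧ m ≠ 0 ∧
      IsHighestWeightVector Q e (fundamentalWeight p s) m := by
  obtain ⟨T, _, _, _, _, α, hT, hα, h0⟩ := exists_alternatingPower (isUnitary_Vc (Q := Q)) s
  let v : Fin s → Vc V := fun i => weightVector Q e (Fin.castLE hs i, 0)
  refine ⟨T, inferInstance, inferInstance, inferInstance, inferInstance, α v, hT,
    h0 (fun i => (weightBasis he hdim).coord (Fin.castLE hs i, 0)) v ?_, ?_, ?_⟩
  · intro i j
    simp only [v, ← weightBasis_apply he hdim, Module.Basis.coord_apply, Module.Basis.repr_self,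
      Finsupp.single_apply, Prod.mk.injEq, Fin.castLE_inj, and_true, @eq_comm _ j i]
  · intro k
    have hv : ∀ i, ⁅((1 : ℂ) ⊗ₜ[ℝ] torusElement Q (e k) : SpC Q), v i⁆ =
        (Complex.I * (weight (Fin.castLE hs i, 0) k : ℂ)) • v i :=
      fun i => hasWeight_weightVector he _ k
    simp only [hα, hv, AlternatingMap.map_update_smul, Function.update_eq_self]
    rw [← Finset.sum_smul, ← Finset.mul_sum, ← Int.cast_sum]
    congr 3
    simp only [weight, fundamentalWeight, Matrix.cons_val_zero, Pi.single_apply]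
    split_ifs with hk
    · rw [Finset.sum_eq_single (⟨k, by exact_mod_cast hk⟩ : Fin s)]
      · exact if_pos rfl
      · intro i _ hi
        refine if_neg fun h => hi ?_
        ext
        simp [h]
      · simp
    · refine Finset.sum_eq_zero fun i _ => if_neg fun h => hk ?_
      rw [h]
      simp
  · intro a x ha hx
    rw [hα]
    refine Finset.sum_eq_zero fun i _ => ?_
    have := lie_weightVector_mem_span he hdim ha hx (Fin.castLE hs i)
    change ⁅x, v i⁆ ∈ _ at this
    generalize ⁅x, v i⁆ = w at this ⊢
    induction this using Submodule.span_induction with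
    | zero => exact α.map_update_zero v i
    | add y z _ _ h1 h2 => rw [AlternatingMap.map_update_add, h1, h2, add_zero]
    | smul c y _ h => rw [AlternatingMap.map_update_smul, h, smul_zero]
    | mem y hy =>
      obtain ⟨l, hl, rfl⟩ := hy
      have hl' : (l : ℕ) < i := hl
      have : weightVector Q e (l, 0) = v ⟨l, hl'.trans i.2⟩ := rfl
      change α (Function.update v i (weightVector Q e (l, 0))) = 0
      rw [this]
      exact α.map_update_self v (fun h => by rw [h] at hl'; exact lt_irrefl _ hl')

end Exterior

/-! ### Complete reducibility of `V_c ⊗ U_s` -/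

section Prod

variable {R L M N : Type*} [CommRing R] [LieRing L] [LieAlgebra R L] [AddCommGroup M] [Module R M]
  [LieRingModule L M] [AddCommGroup N] [Module R N] [LieRingModule L N]

/-- The direct sum of two Lie modules. -/
instance prodLieRingModule : LieRingModule L (M × N) where
  bracket x m := (⁅x, m.1⁆, ⁅x, m.2⁆)
  add_lie x y m := Prod.ext (add_lie x y m.1) (add_lie x y m.2)
  lie_add x m n := Prod.ext (lie_add x m.1 n.1) (lie_add x m.2 n.2)
  leibniz_lie x y m := Prod.ext (leibniz_lie x y m.1) (leibniz_lie x y m.2)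

instance prodLieModule [LieModule R L M] [LieModule R L N] : LieModule R L (M × N) where
  smul_lie c x m := Prod.ext (smul_lie c x m.1) (smul_lie c x m.2)
  lie_smul c x m := Prod.ext (lie_smul c x m.1) (lie_smul c x m.2)

variable (R L M N)

/-- The first projection of a direct sum of Lie modules. -/
def fstHom : M × N →ₗ⁅R,L⁆ M := { LinearMap.fst R M N with map_lie' := rfl }

/-- The second projection of a direct sum of Lie modules. -/
def sndHom : M × N →ₗ⁅R,L⁆ N := { LinearMap.snd R M N with map_lie' := rfl }

end Prod

section Reducibility

universe u

variable {V : Type u} [NormedAddCommGroup V] [InnerProductSpace ℝ V] [FiniteDimensional ℝ V]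
  {Q : HypercomplexStructure V} {p : ℕ} {e : Fin p → V}

/-- An irreducible module with highest weight `l` is a quotient of a submodule of every module that
contains a highest weight vector of weight `l`. -/
theorem exists_surjective_injective (he : IsFrame Q e) (hdim : Module.finrank ℝ V = 4 * p)
    {U T : Type*} [AddCommGroup U] [Module ℂ U] [LieRingModule (SpC Q) U]
    [LieModule ℂ (SpC Q) U] [AddCommGroup T] [Module ℂ T] [LieRingModule (SpC Q) T]
    [LieModule ℂ (SpC Q) T] {l : Fin p → ℤ} (hU : LieModule.IsIrreducible ℂ (SpC Q) U) {m : U}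
    (hm0 : m ≠ 0) (hm : IsHighestWeightVector Q e l m) {m' : T} (hm0' : m' ≠ 0)
    (hm' : IsHighestWeightVector Q e l m') :
    ∃ (N : LieSubmodule ℂ (SpC Q) (U × T)) (f : N →ₗ⁅ℂ,SpC Q⁆ U) (g : N →ₗ⁅ℂ,SpC Q⁆ T),
      Function.Surjective f ∧ Function.Injective g := by
  have hmm : IsHighestWeightVector Q e l (m, m') :=
    ⟨fun k => Prod.ext (hm.1 k) (hm'.1 k),
      fun a x ha hx => Prod.ext (hm.2 a x ha hx) (hm'.2 a x ha hx)⟩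
  -- the submodule generated by the sum of the highest weight vectors
  let N := LieSubmodule.lieSpan ℂ (SpC Q) {(m, m')}
  let f : N →ₗ⁅ℂ,SpC Q⁆ U := (fstHom ℂ (SpC Q) U T).comp N.incl
  let g : N →ₗ⁅ℂ,SpC Q⁆ T := (sndHom ℂ (SpC Q) U T).comp N.incl
  have hmem : (m, m') ∈ N := LieSubmodule.subset_lieSpan rfl
  refine ⟨N, f, g, ?_, ?_⟩
  · rw [← LieModuleHom.range_eq_top]
    refine (hU.eq_bot_or_eq_top _).resolve_left fun h => hm0 ?_
    rw [← LieSubmodule.mem_bot (R := ℂ) (L := SpC Q), ← h]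
    exact ⟨⟨_, hmem⟩, rfl⟩
  · rw [← LieModuleHom.ker_eq_bot, LieSubmodule.eq_bot_iff]
    rintro ⟨⟨u, t⟩, hn⟩ (ht : t = 0)
    subst ht
    rcases hU.eq_bot_or_eq_top (g.ker.map f) with h | h
    · have : u ∈ g.ker.map f := ⟨⟨(u, 0), hn⟩, rfl, rfl⟩
      rw [h, LieSubmodule.mem_bot] at this
      subst this
      rfl
    · -- otherwise `(m, 0)` has the highest weight, but is not a multiple of `(m, m')`
      exfalso
      have : m ∈ g.ker.map f := by rw [h]; trivial
      obtain ⟨⟨⟨u, t⟩, hut⟩, (rfl : t = 0), (rfl : u = m)⟩ := this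
      have hw : HasWeight Q e l (u, (0 : T)) := fun k =>
        Prod.ext (hm.1 k) ((lie_zero _).trans (smul_zero _).symm)
      obtain ⟨c, hc⟩ := Submodule.mem_span_singleton.1
        (hmm.mem_span_of_hasWeight he hdim hut hw)
      have h1 : c • u = u := congrArg Prod.fst hc
      have h2 : c • m' = 0 := congrArg Prod.snd hc
      rcases smul_eq_zero.1 h2 with rfl | h3
      · exact hm0 (by rw [← h1, zero_smul])
      · exact hm0' h3

/-- `V_c ⊗ U_s` is completely reducible: it is a subquotient of a unitary module. -/
theorem complementedLattice_tensor (he : IsFrame Q e) (hdim : Module.finrank ℝ V = 4 * p)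
    {U : Type*} [AddCommGroup U] [Module ℂ U] [LieRingModule (SpC Q) U]
    [LieModule ℂ (SpC Q) U] {s : ℤ} (hU : IsFundamental Q e s U) :
    ComplementedLattice (LieSubmodule ℂ (SpC Q) (Vc V ⊗[ℂ] U)) := by
  obtain ⟨hs0, hsp, hirr, m, hm0, hm1, hm2⟩ := hU
  lift s to ℕ using hs0
  obtain ⟨T, _, _, _, _, m', hT, hm0', hm'⟩ :=
    exists_unitary_highestWeightVector he hdim (by exact_mod_cast hsp : s ≤ p)
  obtain ⟨N, f, g, hf, hg⟩ :=
    exists_surjective_injective he hdim hirr hm0 ⟨hm1, hm2⟩ hm0' hm'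
  have := (isUnitary_Vc.tensorProduct hT).complementedLattice (span_realElements (Q := Q))
  have := complementedLattice_of_injective
    (TensorProduct.LieModule.map (LieModuleHom.id : Vc V →ₗ⁅ℂ,SpC Q⁆ Vc V) g)
    (Module.Flat.lTensor_preserves_injective_linearMap (M := Vc V) (g : N →ₗ[ℂ] T) hg)
  exact complementedLattice_of_surjective
    (TensorProduct.LieModule.map (LieModuleHom.id : Vc V →ₗ⁅ℂ,SpC Q⁆ Vc V) f)
    (LinearMap.lTensor_surjective (Vc V) (g := (f : N →ₗ[ℂ] U)) hf)

end Reducibility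

end SteinWeiss

end

theorem mainTheorem9 {V : Type*} [NormedAddCommGroup V] [InnerProductSpace ℝ V]
    [FiniteDimensional ℝ V] (p : ℕ) (hdim : Module.finrank ℝ V = 4 * p)
    (Q : SteinWeiss.HypercomplexStructure V) (e : Fin p → V) (he : SteinWeiss.IsFrame Q e)
    {U : Type*} [NormedAddCommGroup U] [NormedSpace ℂ U] [FiniteDimensional ℂ U]
    [LieRingModule (SteinWeiss.SpC Q) U] [LieModule ℂ (SteinWeiss.SpC Q) U]
    (s : ℕ) (hU : SteinWeiss.IsFundamental Q e s U)
    (W W' : Fin 2 → LieSubmodule ℂ (SteinWeiss.SpC Q) (SteinWeiss.Vc V))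
    (hW : SteinWeiss.IsIrreducibleDecomposition Q W)
    (hW' : SteinWeiss.IsIrreducibleDecomposition Q W')
    (Ω : Set V) (hΩ : IsOpen Ω) (f : V → U) (hf : ContDiffOn ℝ ∞ f Ω) :
    (∀ ε : ℤˣ,
      (∀ i, ∀ x ∈ Ω, SteinWeiss.steinWeissGradient Q e W s i ε f x = 0) ↔
      (∀ i, ∀ x ∈ Ω, SteinWeiss.steinWeissGradient Q e W' s i ε f x = 0)) ∧
    ((∀ i, ∀ ε : ℤˣ, ∀ x ∈ Ω, SteinWeiss.steinWeissGradient Q e W s i ε f x = 0) ↔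
      (∀ i, ∀ ε : ℤˣ, ∀ x ∈ Ω, SteinWeiss.steinWeissGradient Q e W' s i ε f x = 0)) := by
  have := SteinWeiss.complementedLattice_tensor he hdim hU
  have key : ∀ (ε : ℤˣ) (x : V),
      (∀ i, SteinWeiss.steinWeissGradient Q e W s i ε f x = 0) ↔
        ∀ i, SteinWeiss.steinWeissGradient Q e W' s i ε f x = 0 := fun ε x =>
    (SteinWeiss.forall_summandProjection_eq_zero_iff hW _ _).trans
      (SteinWeiss.forall_summandProjection_eq_zero_iff hW' _ _).symm
  refine ⟨fun ε => ⟨fun h i x hx => (key ε x).1 (fun i => h i x hx) i,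
    fun h i x hx => (key ε x).2 (fun i => h i x hx) i⟩,
    fun h i ε x hx => (key ε x).1 (fun i => h i ε x hx) i,
    fun h i ε x hx => (key ε x).2 (fun i => h i ε x hx) i⟩
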